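/- For positive integers $n,m$ let $T_{n,m}=\mathbb Z/n\mathbb Z\times\mathbb Z/m\mathbb Z$, and let $\phi\colon T_{n,m}\to T_{n,m}$ be the random map (the quenched random walk, or equivalently the uniform cycle-rooted spanning forest) for which $\phi(x,y)$ equals $(x+1,y)$ or $(x,y+1)$ with probability $1/2$ each, independently over the vertices $(x,y)\in T_{n,m}$. A closed orbit (cycle) of $\phi$ has homology class $(p,q)$ if it crosses every vertical line $x=a+\frac12$ exactly $p$ times and every horizontal line $y=b+\frac12$ exactly $q$ times, where $a\in\mathbb Z/n\mathbb Z$ and $b\in\mathbb Z/m\mathbb Z$; let $N_{(p,q)}$ denote the number of closed orbits of homology class $(p,q)$. Let $\rho\in(0,\infty)$. There exist constants $c>0$ and $C>0$, depending only on $\rho$, such that for every sequence $m=m(n)$ of natural numbers with $m=n+\rho\sqrt n\,(1+o(1))$ as $n\to\infty$, the following hold for all sufficiently large $n$ (how large may depend on the sequence): $$\mathbb P\big(\text{every closed orbit of }\phi\text{ has homology class }(1,1)\big)>1-\exp\{-cn^{1/2}\},$$ $$\mathbb P\big(N_{(1,1)}>cn^{1/2}\big)\ge 1-\exp\{-cn^{1/2}\},$$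 $$\mathbb P\big(N_{(1,1)}>Cn^{1/2}\big)\le\exp\{-C^{-1}n^{1/2}\}.$$ -/

import Mathlib

open MeasureTheory Filter Topology Asymptotics

namespace QuenchedWalk

/-- The torus `ℤ² / (nℤ × mℤ)`. -/
abbrev Torus (n m : ℕ) : Type := ZMod n × ZMod m

/-- A choice of an outgoing edge at every vertex of the torus: `true` is the edge pointing right,
to `(x + 1, y)`, and `false` is the edge pointing up, to `(x, y + 1)`. Equivalently, a
cycle-rooted spanning forest of the directed torus. -/
abbrev Config (n m : ℕ) : Type := Torus n m → Bool

/-- The quenched random walk of a configuration, as a self-map of the torus. -/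
def walk {n m : ℕ} (ω : Config n m) (v : Torus n m) : Torus n m :=
  if ω v = true then (v.1 + 1, v.2) else (v.1, v.2 + 1)

/-- The law of the configuration: right and up have probability `1 / 2` each, independently over
the vertices of the torus. -/
noncomputable def law (n m : ℕ) : Measure (Config n m) :=
  Measure.infinitePi fun _ : Torus n m => (PMF.uniformOfFintype Bool).toMeasure

/-- `C` is (the vertex set of) a closed orbit of the quenched random walk. -/
def IsClosedOrbit {n m : ℕ} (ω : Config n m) (C : Set (Torus n m)) : Prop :=
  ∃ v ∈ Function.periodicPts (walk ω), C = {w | w ∈ Function.periodicOrbit (walk ω) v}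

/-- The closed orbit `C` has homology class `(p, q)`: it crosses every vertical line
`x = a + 1/2` exactly `p` times (by a right step from a vertex of abscissa `a`), and every
horizontal line `y = b + 1/2` exactly `q` times (by an up step from a vertex of ordinate `b`). -/
def HasHomologyClass {n m : ℕ} (ω : Config n m) (C : Set (Torus n m)) (p q : ℕ) : Prop :=
  (∀ a : ZMod n, {v | v ∈ C ∧ v.1 = a ∧ ω v = true}.ncard = p) ∧
    ∀ b : ZMod m, {v | v ∈ C ∧ v.2 = b ∧ ω v = false}.ncard = q

/-- The number of closed orbits of homology class `(p, q)`. -/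
noncomputable def numCycles {n m : ℕ} (p q : ℕ) (ω : Config n m) : ℕ :=
  {C : Set (Torus n m) | IsClosedOrbit ω C ∧ HasHomologyClass ω C p q}.ncard

end QuenchedWalk

/-! Everything rests on one remark: as long as an orbit meets only new vertices, its steps are fair
coin flips, so each prescribed self-avoiding path of length `T` has probability `2 ^ (-T)`.

Homology classes. A closed orbit makes `p * n` right and `q * m` up steps. The number of right steps
in a window of length `n + m` changes by at most one when the window slides by one, and a window
with exactly `n` right steps closes up the orbit. If `p = q`, windows average `n` right steps, so
one has exactly `n`, and the class is `(1, 1)` (`minimalPeriod_of_ups_eq`). If `p ≠ q`, there are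
two cases. An orbit longer than about `√n` turns has all its consecutive blocks on the same side of
`n`; as a binomial variable lies on either strict side with probability at most `1 - δ`, this costs
`2 * (1 - δ) ^ J` (`law_real_injOn_le`). A shorter orbit has `|p * n - q * m| ≥ n / 2` over a length
`O(n ^ (3/2))`, a deviation of probability `exp (-√n / 48)` at most. A union bound over starting
points and classes loses only a polynomial factor (`law_real_offDiagonal_le`).

Upper tail. Distinct cycles are disjoint, so the probability that a given set of `k` points starts
`k` distinct `(1, 1)` cycles is at most `q ^ k`, where `q = (n + m).choose n / 2 ^ (n + m)` is of
order `1 / √n`. Hence `E[2 ^ N] ≤ (1 + q) ^ m ≤ exp (m * q)`, and Markov's inequality concludes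
(`law_real_lt_numCycles_le`).

Lower tail. The rows of the transition matrix `P_ω` of `walk ω` are independent and the determinant
is linear in each row, so `E[det (1 - s P_ω)] = det (1 - s P)`, with `P` the mean matrix. Expanding
`log det` in traces, the right side is at most `exp (-s ^ (n + m) * tr (P ^ (n + m)) / (n + m))`, of
order `exp (-const * √n)`. If all cycles have class `(1, 1)` and `s ^ (n + m) = 1 / 2`, then `det (1
- s P_ω) ≥ exp (-2 * N)`. So few cycles are exponentially unlikely (`law_real_numCycles_le`). -/

namespace QuenchedWalk

/-! ### Expansion of the logarithm of a determinant in traces of powers -/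

section LogDet

open Polynomial

variable {V : Type*} [Fintype V] [DecidableEq V]

theorem det_sub_scalar (M : Matrix V V ℂ) (a : ℂ) :
    (M - algebraMap ℂ _ a).det = (M.charpoly.roots.map fun l => l - a).prod := by
  have h1 : (algebraMap ℂ (Matrix V V ℂ) a - M).det = (M.charpoly.roots.map fun l => a - l).prod := by
    have h2 := (IsAlgClosed.splits M.charpoly).eq_prod_roots_of_monic M.charpoly_monic
    have h3 : M.charpoly.eval a = (algebraMap ℂ (Matrix V V ℂ) a - M).det := by
      rw [Matrix.eval_charpoly]; rfl
    rw [← h3]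
    conv_lhs => rw [h2]
    rw [eval_multiset_prod, Multiset.map_map]
    simp
  have hcard : Multiset.card M.charpoly.roots = Fintype.card V := by
    rw [← (IsAlgClosed.splits M.charpoly).natDegree_eq_card_roots, M.charpoly_natDegree_eq_dim]
  have h4 : M - algebraMap ℂ _ a = -(algebraMap ℂ _ a - M) := by abel
  rw [h4, Matrix.det_neg, h1, ← hcard]
  have : (fun l => l - a) = fun l : ℂ => (-1) * (a - l) := by ext; ring
  rw [this, Multiset.prod_map_mul]
  simp

/-- Spectral mapping with multiplicities: `p` splits over `ℂ`, and each linear factor contributes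
the determinant of a scalar shift of `M`. -/
theorem det_aeval (M : Matrix V V ℂ) (p : ℂ[X]) :
    (aeval M p).det = (M.charpoly.roots.map fun l => p.eval l).prod := by
  have hcard : Multiset.card M.charpoly.roots = Fintype.card V := by
    rw [← (IsAlgClosed.splits M.charpoly).natDegree_eq_card_roots, M.charpoly_natDegree_eq_dim]
  have h := (IsAlgClosed.splits p).eq_prod_roots
  generalize p.leadingCoeff = c at h
  generalize p.roots = s at h
  subst h
  rw [map_mul, Matrix.det_mul]
  simp only [eval_mul, eval_C, aeval_C]
  rw [Multiset.prod_map_mul]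
  congr 1
  · rw [Algebra.algebraMap_eq_smul_one, Matrix.det_smul, Matrix.det_one]
    simp [hcard]
  · induction s using Multiset.induction with
    | empty => simp
    | cons b s ih =>
      simp only [Multiset.map_cons, Multiset.prod_cons, map_mul, Matrix.det_mul, eval_mul]
      rw [ih, Multiset.prod_map_mul]
      congr 1
      simp only [map_sub, aeval_X, aeval_C, det_sub_scalar]
      simp

theorem charpoly_aeval (M : Matrix V V ℂ) (p : ℂ[X]) :
    (aeval M p).charpoly = (M.charpoly.roots.map fun l => X - C (p.eval l)).prod := by
  refine Polynomial.funext fun x => ?_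
  have h1 : (aeval M p).charpoly.eval x = (aeval M (C x - p)).det := by
    rw [Matrix.eval_charpoly, map_sub, aeval_C]; rfl
  rw [h1, det_aeval, eval_multiset_prod, Multiset.map_map]
  simp

theorem trace_pow_eq_sum_roots (M : Matrix V V ℂ) (k : ℕ) :
    (M ^ k).trace = (M.charpoly.roots.map fun l => l ^ k).sum := by
  have h := charpoly_aeval M (X ^ k)
  simp only [map_pow (aeval M), aeval_X, eval_pow, eval_X] at h
  rw [Matrix.trace_eq_sum_roots_charpoly, h]
  have : (M.charpoly.roots.map fun l => X - C (l ^ k))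
      = (M.charpoly.roots.map fun l => l ^ k).map fun a => X - C a := by
    rw [Multiset.map_map]; rfl
  rw [this, roots_multiset_prod_X_sub_C]

theorem norm_le_of_mem_roots_charpoly (M : Matrix V V ℂ) (s : ℝ) (hs : 0 ≤ s)
    (hM : ∀ i, ∑ j, ‖M i j‖ ≤ s) {l : ℂ} (hl : l ∈ M.charpoly.roots) : ‖l‖ ≤ s := by
  let _ : NormedRing (Matrix V V ℂ) := Matrix.linftyOpNormedRing
  let _ : NormedAlgebra ℂ (Matrix V V ℂ) := Matrix.linftyOpNormedAlgebra
  have hn : ‖M‖ ≤ s := by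
    rw [Matrix.linfty_opNorm_def]
    lift s to NNReal using hs
    refine NNReal.coe_le_coe.2 (Finset.sup_le fun i _ => ?_)
    have := hM i
    rw [← NNReal.coe_le_coe]
    push_cast
    exact this
  have hroot : M.charpoly.IsRoot l := isRoot_of_mem_roots hl
  have hsp : l ∈ spectrum ℂ M := (Matrix.mem_spectrum_iff_isRoot_charpoly).2 hroot
  have : Nonempty V := by
    by_contra hV
    rw [not_nonempty_iff] at hV
    simp [Matrix.charpoly, Matrix.det_isEmpty] at hl
  have : NormOneClass (Matrix V V ℂ) := Matrix.linfty_opNormOneClass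
  have : CompleteSpace (Matrix V V ℂ) := inferInstanceAs (CompleteSpace (V → V → ℂ))
  exact (spectrum.norm_le_norm_of_mem hsp).trans hn

/-- The row sums bound all eigenvalues by `s < 1`, so the Taylor series of `-log (1 - l)` can be
added over the eigenvalues; exponentiating removes any question of branch. The term `k = 0` is a
division by zero, hence `0`. -/
theorem exists_hasSum_trace_pow_div_complex (M : Matrix V V ℂ) (s : ℝ) (hs : 0 ≤ s) (hs1 : s < 1)
    (hM : ∀ i, ∑ j, ‖M i j‖ ≤ s) :
    ∃ S : ℂ, HasSum (fun k : ℕ => (M ^ k).trace / k) S ∧ (1 - M).det = Complex.exp (-S) := by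
  have hl : ∀ l ∈ M.charpoly.roots, ‖l‖ < 1 := fun l h =>
    (norm_le_of_mem_roots_charpoly M s hs hM h).trans_lt hs1
  have hdet := det_aeval M (1 - X)
  simp only [map_sub, map_one, aeval_X, eval_sub, eval_one, eval_X] at hdet
  rw [hdet]
  simp only [trace_pow_eq_sum_roots]
  generalize M.charpoly.roots = t at hl
  induction t using Multiset.induction with
  | empty => exact ⟨0, by simp, by simp⟩
  | cons a t ih =>
    obtain ⟨S, h1, h2⟩ := ih fun l h => hl l (Multiset.mem_cons_of_mem h)
    have ha := hl a (Multiset.mem_cons_self a t)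
    refine ⟨-Complex.log (1 - a) + S, ?_, ?_⟩
    · have := (Complex.hasSum_taylorSeries_neg_log ha).add h1
      convert! this using 2 with k
      simp [add_div]
    · rw [Multiset.map_cons, Multiset.prod_cons, h2, neg_add, neg_neg, Complex.exp_add,
        Complex.exp_log]
      intro h0
      have : a = 1 := (sub_eq_zero.1 h0).symm
      simp [this] at ha

/-- For a real matrix of row sums below one, `det (1 - M) = exp (-∑ tr (M ^ k) / k)`. -/
theorem exists_hasSum_trace_pow_div (M : Matrix V V ℝ) (s : ℝ) (hs : 0 ≤ s) (hs1 : s < 1)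
    (hM : ∀ i, ∑ j, |M i j| ≤ s) :
    ∃ S : ℝ, HasSum (fun k : ℕ => (M ^ k).trace / k) S ∧ (1 - M).det = Real.exp (-S) := by
  obtain ⟨S, h1, h2⟩ := exists_hasSum_trace_pow_div_complex (M.map Complex.ofReal) s hs hs1
    (by simpa using hM)
  have htr : ∀ k : ℕ, ((M.map Complex.ofReal) ^ k).trace / k = (((M ^ k).trace / k : ℝ) : ℂ) := by
    intro k
    have : (M.map Complex.ofReal) ^ k = (M ^ k).map Complex.ofReal :=
      (map_pow (Complex.ofRealHom.mapMatrix) M k).symm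
    rw [this]
    simp [Matrix.trace]
  simp only [htr] at h1
  have h3 : HasSum (fun k : ℕ => (M ^ k).trace / k) S.re := by
    simpa using Complex.hasSum_re h1
  have h4 : S = ((S.re : ℝ) : ℂ) := h1.unique (Complex.hasSum_ofReal.2 h3)
  refine ⟨S.re, h3, ?_⟩
  have h5 : (1 - M.map Complex.ofReal).det = (((1 - M).det : ℝ) : ℂ) := by
    have : (1 - M.map Complex.ofReal) = Complex.ofRealHom.mapMatrix (1 - M) := by
      rw [map_sub, map_one]; rfl
    rw [this, ← RingHom.map_det]; rfl
  rw [h5, h4] at h2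
  exact_mod_cast h2

end LogDet

/-! ### Binomial estimates: local bounds at the centre and a Gaussian tail -/

section Binomial

theorem centralBinom_succ_real (n : ℕ) :
    (Nat.centralBinom (n + 1) : ℝ) = 2 * (2 * n + 1) / (n + 1) * Nat.centralBinom n := by
  have h := Nat.succ_mul_centralBinom_succ n
  have h' : ((n : ℝ) + 1) * Nat.centralBinom (n + 1) = 2 * (2 * n + 1) * Nat.centralBinom n := by
    exact_mod_cast h
  field_simp
  linarith

theorem two_mul_add_one_mul_centralBinom_sq_le (n : ℕ) :
    (2 * n + 1) * (Nat.centralBinom n : ℝ) ^ 2 ≤ 16 ^ n := by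
  induction n with
  | zero => simp
  | succ n ih =>
    rw [centralBinom_succ_real, pow_succ (16 : ℝ)]
    have h : (2 * ((n + 1 : ℕ) : ℝ) + 1) * (2 * (2 * n + 1) / (n + 1) * Nat.centralBinom n) ^ 2
        = (4 * (2 * n + 3) * (2 * n + 1) / (n + 1) ^ 2)
          * ((2 * n + 1) * (Nat.centralBinom n : ℝ) ^ 2) := by
      push_cast; field_simp; ring
    rw [h, mul_comm]
    refine mul_le_mul ih ?_ (by positivity) (by positivity)
    rw [div_le_iff₀ (by positivity)]
    nlinarith

theorem pow_le_four_mul_mul_centralBinom_sq (n : ℕ) (hn : 1 ≤ n) :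
    (16 : ℝ) ^ n ≤ 4 * n * (Nat.centralBinom n : ℝ) ^ 2 := by
  induction n, hn using Nat.le_induction with
  | base => norm_num [Nat.centralBinom, Nat.choose]
  | succ n hn ih =>
    have hn' : (1 : ℝ) ≤ n := by exact_mod_cast hn
    rw [centralBinom_succ_real, pow_succ (16 : ℝ)]
    have h : 4 * ((n + 1 : ℕ) : ℝ) * (2 * (2 * n + 1) / (n + 1) * Nat.centralBinom n) ^ 2
        = (4 * n * (Nat.centralBinom n : ℝ) ^ 2) * (4 * (2 * n + 1) ^ 2 / ((n + 1) * n)) := by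
      push_cast; field_simp; norm_num
    rw [h]
    refine mul_le_mul ih ?_ (by positivity) (by positivity)
    rw [le_div_iff₀ (by positivity)]
    nlinarith

theorem choose_succ_div_two_pow (k n : ℕ) (h : n ≤ k) :
    ((k + 1).choose n : ℝ) / 2 ^ (k + 1)
      = ((k.choose n : ℝ) / 2 ^ k) * (((k : ℝ) + 1) / (2 * (k + 1 - n))) := by
  have h1 := Nat.choose_mul_succ_eq k n
  have h2 : (k.choose n : ℝ) * (k + 1) = (k + 1).choose n * (k + 1 - n) := by
    have : ((k + 1 - n : ℕ) : ℝ) = k + 1 - n := by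
      rw [Nat.cast_sub (by omega)]; push_cast; ring
    rw [← this]; exact_mod_cast h1
  have h3 : (0 : ℝ) < k + 1 - n := by
    have : (n : ℝ) ≤ k := by exact_mod_cast h
    linarith
  have h4 : ((k + 1).choose n : ℝ) = (k.choose n : ℝ) * (k + 1) / (k + 1 - n) := by
    rw [h2]; field_simp
  rw [h4, pow_succ]
  field_simp

theorem choose_div_two_pow_le (n m : ℕ) (hn : 1 ≤ n) (hm : n ≤ m) :
    ((n + m).choose n : ℝ) / 2 ^ (n + m) ≤ 1 / √n := by
  have hn' : (1 : ℝ) ≤ n := by exact_mod_cast hn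
  have h0 : ((n + m).choose n : ℝ) / 2 ^ (n + m) ≤ Nat.centralBinom n / 4 ^ n := by
    induction m, hm using Nat.le_induction with
    | base =>
      rw [Nat.centralBinom, two_mul, ← two_mul, pow_mul]
      norm_num
    | succ m hm ih =>
      refine le_trans ?_ ih
      rw [← add_assoc, choose_succ_div_two_pow _ _ (by omega)]
      refine mul_le_of_le_one_right (by positivity) ?_
      have : (n : ℝ) ≤ m := by exact_mod_cast hm
      push_cast
      rw [div_le_one (by linarith)]
      linarith
  refine h0.trans ?_
  rw [div_le_div_iff₀ (by positivity) (by positivity), one_mul]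
  refine (sq_le_sq₀ (by positivity) (by positivity)).1 ?_
  rw [mul_pow, Real.sq_sqrt (by positivity), ← pow_mul, mul_comm n 2, pow_mul]
  have := two_mul_add_one_mul_centralBinom_sq_le n
  norm_num
  nlinarith [sq_nonneg (Nat.centralBinom n : ℝ)]

/-- Moving `d` off the centre to `d + 1` multiplies the ratio by at least `exp (-(d + 1) / n)`, and
`d ^ 2 + (d + 1) ≤ (d + 1) ^ 2`. -/
theorem le_choose_div_two_pow (n d : ℕ) (hn : 1 ≤ n) :
    Real.exp (-((d : ℝ) ^ 2 / n)) / (2 * √n) ≤ ((2 * n + d).choose n : ℝ) / 2 ^ (2 * n + d) := by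
  have hn' : (1 : ℝ) ≤ n := by exact_mod_cast hn
  induction d with
  | zero =>
    have h := pow_le_four_mul_mul_centralBinom_sq n hn
    simp only [Nat.cast_zero, ne_eq, OfNat.ofNat_ne_zero, not_false_eq_true, zero_pow, zero_div,
      neg_zero, Real.exp_zero, add_zero]
    rw [div_le_div_iff₀ (by positivity) (by positivity), one_mul, pow_mul]
    change _ ≤ (Nat.centralBinom n : ℝ) * _
    refine (sq_le_sq₀ (by positivity) (by positivity)).1 ?_
    rw [mul_pow, mul_pow, Real.sq_sqrt (by positivity), ← pow_mul, mul_comm n 2, pow_mul]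
    norm_num
    linarith
  | succ d ih =>
    rw [← add_assoc, choose_succ_div_two_pow _ _ (by omega)]
    have hx : Real.exp (-(((d : ℝ) + 1) / n)) ≤
        (((2 * n + d : ℕ) : ℝ) + 1) / (2 * ((2 * n + d : ℕ) + 1 - n)) := by
      rw [Real.exp_neg]
      have h1 : 1 + ((d : ℝ) + 1) / n ≤ Real.exp (((d : ℝ) + 1) / n) := by
        rw [add_comm]; exact Real.add_one_le_exp _
      refine (inv_anti₀ (by positivity) h1).trans ?_
      push_cast
      have h2 : (2 * (n : ℝ) + d + 1 - n) = n + d + 1 := by ring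
      rw [h2, inv_eq_one_div, div_le_div_iff₀ (by positivity) (by positivity)]
      have h3 : (2 * (n : ℝ) + d + 1) * (1 + ((d : ℝ) + 1) / n) =
        2 * n + d + 1 + 2 * (d + 1) + (d + 1) ^ 2 / n := by field_simp; ring
      rw [h3]
      have : (0 : ℝ) ≤ (d + 1) ^ 2 / n := by positivity
      have hd : (0 : ℝ) ≤ d := by positivity
      linarith
    refine le_trans ?_ (mul_le_mul ih hx (by positivity) (by positivity))
    rw [div_mul_eq_mul_div, ← Real.exp_add]
    gcongr
    rw [← neg_add, ← add_div]
    gcongr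
    push_cast
    have hd : (0 : ℝ) ≤ d := by positivity
    nlinarith

theorem choose_le_two_pow_mul_exp (L j : ℕ) (hL : 1 ≤ L) :
    (L.choose j : ℝ) ≤ 2 ^ L * Real.exp (-((2 * j - L : ℝ) ^ 2 / (2 * L))) := by
  have hL' : (1 : ℝ) ≤ L := by exact_mod_cast hL
  rcases lt_or_ge L j with hj | hj
  · rw [Nat.choose_eq_zero_of_lt hj]; push_cast; positivity
  -- Chernoff's exponential tilt: this `t` minimises `L * t ^ 2 / 2 - t * (2 * j - L)`.
  set t : ℝ := (2 * j - L) / L with ht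
  have h1 : Real.exp t ^ j * Real.exp (-t) ^ (L - j) * L.choose j ≤
      (Real.exp t + Real.exp (-t)) ^ L := by
    rw [add_pow]
    exact Finset.single_le_sum
      (f := fun i => Real.exp t ^ i * Real.exp (-t) ^ (L - i) * (L.choose i : ℝ))
      (fun i _ => by positivity) (Finset.mem_range.2 (by omega))
  have h2 : (Real.exp t + Real.exp (-t)) ^ L ≤ 2 ^ L * Real.exp (L * (t ^ 2 / 2)) := by
    have : Real.exp t + Real.exp (-t) = 2 * Real.cosh t := by rw [Real.cosh_eq]; ring
    rw [this, mul_pow, Real.exp_nat_mul]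
    gcongr
    exact Real.cosh_le_exp_half_sq t
  have h3 : Real.exp t ^ j * Real.exp (-t) ^ (L - j) = Real.exp (t * (2 * j - L)) := by
    rw [← Real.exp_nat_mul, ← Real.exp_nat_mul, ← Real.exp_add, Nat.cast_sub hj]
    congr 1; ring
  rw [h3] at h1
  have h4 := h1.trans h2
  have h5 : -((2 * j - L : ℝ) ^ 2 / (2 * L)) = L * (t ^ 2 / 2) - t * (2 * j - L) := by
    rw [ht]; field_simp; ring
  rw [h5, Real.exp_sub, ← mul_div_assoc, le_div_iff₀ (Real.exp_pos _), mul_comm]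
  exact h4

/-- A binomial variable of mean `(n + m) / 2` is at most `n` with probability bounded below, if
`m - n` is of the order of `√n`. -/
theorem le_sum_choose (ρ : ℝ) (hρ : 0 < ρ) (n m : ℕ) (hn : 4 ≤ n) (hnm : n ≤ m)
    (hm : (m : ℝ) ≤ n + 2 * ρ * √n) :
    Real.exp (-(8 * (ρ + 1) ^ 2)) / 2 * 2 ^ (n + m)
      ≤ ∑ j ∈ Finset.range (n + 1), ((n + m).choose j : ℝ) := by
  set r := Nat.sqrt n with hr
  have hn' : (4 : ℝ) ≤ n := by exact_mod_cast hn
  have hrr : r * r ≤ n := Nat.sqrt_le n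
  have hr2 : 2 ≤ r := by rw [hr, Nat.le_sqrt]; omega
  have hr1 : √(n : ℝ) ≤ r + 1 := by
    rw [Real.sqrt_le_left (by positivity)]
    have := (Nat.lt_succ_sqrt n).le
    have h : (n : ℝ) ≤ (r + 1) * (r + 1) := by exact_mod_cast this
    nlinarith
  have hr3 : (r : ℝ) ≤ √(n : ℝ) := Real.le_sqrt_of_sq_le (by rw [sq]; exact_mod_cast hrr)
  have hrn : 2 * r ≤ n := le_trans (Nat.mul_le_mul_right r hr2) hrr
  have hsq : √(n : ℝ) ^ 2 = n := Real.sq_sqrt (by positivity)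
  have hsp : 0 < √(n : ℝ) := Real.sqrt_pos.2 (by linarith)
  -- The window has `r + 1 ≥ √n` terms, each of order `2 ^ (n + m) / √n`: there `n + m - 2 * j ≤ 2 *
  -- (ρ + 1) * √n` and `j ≥ n / 2`.
  have key : ∀ j ∈ Finset.Icc (n - r) n,
      Real.exp (-(8 * (ρ + 1) ^ 2)) / (2 * √n) * 2 ^ (n + m) ≤ ((n + m).choose j : ℝ) := by
    intro j hj
    rw [Finset.mem_Icc] at hj
    have hj1 : 1 ≤ j := by omega
    have hj2 : (n : ℝ) ≤ 2 * j := by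
      have : n ≤ 2 * j := by omega
      exact_mod_cast this
    have hj3 : (n : ℝ) ≤ j + r := by
      have : n ≤ j + r := by omega
      exact_mod_cast this
    have hj4 : (j : ℝ) ≤ n := by exact_mod_cast hj.2
    have h := le_choose_div_two_pow j (n + m - 2 * j) hj1
    rw [show 2 * j + (n + m - 2 * j) = n + m by omega, le_div_iff₀ (by positivity)] at h
    refine le_trans ?_ h
    have hd : ((n + m - 2 * j : ℕ) : ℝ) ≤ 2 * (ρ + 1) * √n := by
      rw [Nat.cast_sub (by omega)]; push_cast; nlinarith
    have hd2 : ((n + m - 2 * j : ℕ) : ℝ) ^ 2 / j ≤ 8 * (ρ + 1) ^ 2 := by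
      rw [div_le_iff₀ (by linarith)]
      calc ((n + m - 2 * j : ℕ) : ℝ) ^ 2 ≤ (2 * (ρ + 1) * √n) ^ 2 := by gcongr
        _ = 4 * (ρ + 1) ^ 2 * n := by rw [mul_pow, hsq]; ring
        _ ≤ 4 * (ρ + 1) ^ 2 * (2 * j) := by gcongr
        _ = _ := by ring
    gcongr
  have hsub : Finset.Icc (n - r) n ⊆ Finset.range (n + 1) := by
    intro j hj
    rw [Finset.mem_Icc] at hj
    rw [Finset.mem_range]; omega
  refine le_trans ?_ (Finset.sum_le_sum_of_subset_of_nonneg hsub fun _ _ _ => by positivity)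
  refine le_trans ?_ (Finset.card_nsmul_le_sum _ _ _ key)
  rw [Nat.card_Icc, show n + 1 - (n - r) = r + 1 by omega, nsmul_eq_mul]
  push_cast
  have : Real.exp (-(8 * (ρ + 1) ^ 2)) / 2 * 2 ^ (n + m)
    = √n * (Real.exp (-(8 * (ρ + 1) ^ 2)) / (2 * √n) * 2 ^ (n + m)) := by
    field_simp
  rw [this]
  gcongr

end Binomial

/-! ### Deterministic study of orbits: sliding windows and homology classes -/

section Orbits

open Function

variable {n m : ℕ}

/-- The number of right steps among the first `k` steps of the orbit of `v`. -/
def rights (ω : Config n m) (v : Torus n m) (k : ℕ) : ℕ :=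
  Nat.count (fun i => ω ((walk ω)^[i] v) = true) k

/-- The number of up steps among the first `k` steps of the orbit of `v`. -/
def ups (ω : Config n m) (v : Torus n m) (k : ℕ) : ℕ :=
  Nat.count (fun i => ω ((walk ω)^[i] v) = false) k

theorem rights_succ (ω : Config n m) (v : Torus n m) (k : ℕ) :
    rights ω v (k + 1) = rights ω v k + if ω ((walk ω)^[k] v) = true then 1 else 0 :=
  Nat.count_succ _ _

theorem ups_succ (ω : Config n m) (v : Torus n m) (k : ℕ) :
    ups ω v (k + 1) = ups ω v k + if ω ((walk ω)^[k] v) = false then 1 else 0 :=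
  Nat.count_succ _ _

theorem rights_add_ups (ω : Config n m) (v : Torus n m) (k : ℕ) :
    rights ω v k + ups ω v k = k := by
  induction k with
  | zero => simp [rights, ups]
  | succ k ih =>
    rw [rights_succ, ups_succ]
    cases ω ((walk ω)^[k] v) <;> simp <;> omega

theorem rights_add (ω : Config n m) (v : Torus n m) (a b : ℕ) :
    rights ω v (a + b) = rights ω v a + rights ω ((walk ω)^[a] v) b := by
  rw [rights, rights, rights, Nat.count_add]
  simp only [← iterate_add_apply, add_comm a]

theorem iterate_walk (ω : Config n m) (v : Torus n m) (k : ℕ) :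
    (walk ω)^[k] v = (v.1 + rights ω v k, v.2 + ups ω v k) := by
  induction k with
  | zero => simp [rights, ups]
  | succ k ih =>
    rw [rights_succ, ups_succ, iterate_succ_apply']
    cases h : ω ((walk ω)^[k] v)
    · rw [walk, if_neg (by simp [h]), ih]
      simp [add_assoc]
    · rw [walk, if_pos h, ih]
      simp [add_assoc]

theorem iterate_walk_eq_self_of_rights_eq (ω : Config n m) (v : Torus n m)
    (h : rights ω v (n + m) = n) : (walk ω)^[n + m] v = v := by
  have h2 := rights_add_ups ω v (n + m)
  rw [iterate_walk, h, show ups ω v (n + m) = m by omega]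
  simp

theorem rights_iterate_succ (ω : Config n m) (v : Torus n m) (k t : ℕ) :
    rights ω ((walk ω)^[t + 1] v) k ≤ rights ω ((walk ω)^[t] v) k + 1 ∧
      rights ω ((walk ω)^[t] v) k ≤ rights ω ((walk ω)^[t + 1] v) k + 1 := by
  have h1 := rights_add ω v (t + 1) k
  have h2 := rights_add ω v t k
  have h3 := rights_succ ω v t
  have h4 := rights_succ ω v (t + k)
  rw [show t + 1 + k = t + k + 1 by ring] at h1
  split_ifs at h3 h4 <;> omega

/-- Discrete intermediate value theorem: sliding the window by one drops one step and gains one, so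
the count cannot jump over `j`. -/
theorem forall_lt_rights_or_forall_rights_lt (ω : Config n m) (v : Torus n m) (k j T : ℕ)
    (h : ∀ t ≤ T, rights ω ((walk ω)^[t] v) k ≠ j) :
    (∀ t ≤ T, j < rights ω ((walk ω)^[t] v) k) ∨ ∀ t ≤ T, rights ω ((walk ω)^[t] v) k < j := by
  induction T with
  | zero =>
    rcases lt_or_gt_of_ne (h 0 le_rfl) with h0 | h0
    · exact Or.inr fun t ht => by rwa [Nat.le_zero.1 ht]
    · exact Or.inl fun t ht => by rwa [Nat.le_zero.1 ht]
  | succ T ih =>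
    have hs := rights_iterate_succ ω v k T
    have hT := h (T + 1) le_rfl
    rcases ih fun t ht => h t (by omega) with h0 | h0
    · refine Or.inl fun t ht => ?_
      rcases Nat.lt_or_ge T t with h1 | h1
      · obtain rfl : t = T + 1 := by omega
        have := h0 T le_rfl
        omega
      · exact h0 t h1
    · refine Or.inr fun t ht => ?_
      rcases Nat.lt_or_ge T t with h1 | h1
      · obtain rfl : t = T + 1 := by omega
        have := h0 T le_rfl
        omega
      · exact h0 t h1

theorem forall_block_of_injOn [NeZero n] (ω : Config n m) (v : Torus n m) (J : ℕ)
    (h : Set.InjOn (fun i => (walk ω)^[i] v) (Set.Iic (J * (n + m)))) :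
    (∀ j < J, n < rights ω ((walk ω)^[j * (n + m)] v) (n + m)) ∨
      ∀ j < J, rights ω ((walk ω)^[j * (n + m)] v) (n + m) < n := by
  have hn : 0 < n := Nat.pos_of_neZero n
  rcases J with _ | J
  · exact Or.inl fun j hj => absurd hj (Nat.not_lt_zero j)
  have hle : ∀ j < J + 1, j * (n + m) ≤ J * (n + m) := fun j hj =>
    Nat.mul_le_mul_right _ (by omega)
  refine (forall_lt_rights_or_forall_rights_lt ω v (n + m) n (J * (n + m)) fun t ht h0 => ?_).imp
    (fun h1 j hj => h1 _ (hle j hj)) fun h1 j hj => h1 _ (hle j hj)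
  have h1 := iterate_walk_eq_self_of_rights_eq ω _ h0
  rw [← iterate_add_apply] at h1
  -- With `J + 1` blocks, the last window starts at time `J * (n + m)` and returns at time `(J + 1)
  -- * (n + m)`, which is why injectivity is needed on the closed interval.
  have h2 := h (x₁ := n + m + t) (x₂ := t) (by simp only [Set.mem_Iic]; linarith)
    (by simp only [Set.mem_Iic]; linarith) h1
  omega

theorem minimalPeriod_of_ups_eq [NeZero n] [NeZero m] (ω : Config n m) (v : Torus n m)
    (hv : v ∈ periodicPts (walk ω))
    (h : n * ups ω v (minimalPeriod (walk ω) v) = m * rights ω v (minimalPeriod (walk ω) v)) :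
    minimalPeriod (walk ω) v = n + m ∧ rights ω v (n + m) = n ∧ ups ω v (n + m) = m := by
  have hn : 0 < n := Nat.pos_of_neZero n
  have hm : 0 < m := Nat.pos_of_neZero m
  have hL0 := minimalPeriod_pos_of_mem_periodicPts hv
  have hper := isPeriodicPt_minimalPeriod (walk ω) v
  have hadd := rights_add_ups ω v (minimalPeriod (walk ω) v)
  have hfix : (walk ω)^[minimalPeriod (walk ω) v] v = v := hper
  rw [iterate_walk, Prod.ext_iff] at hfix
  simp only [add_eq_left, ZMod.natCast_eq_zero_iff] at hfix
  obtain ⟨⟨p, hp⟩, q, hq⟩ := hfix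
  rw [hp, hq] at h hadd
  have hpq : p = q := by
    have : n * m * p = n * m * q := by linarith
    exact Nat.eq_of_mul_eq_mul_left (Nat.mul_pos hn hm) this
  subst hpq
  have hL : minimalPeriod (walk ω) v = p * (n + m) := by linarith
  have hp0 : 0 < p := by
    rcases Nat.eq_zero_or_pos p with h0 | h0
    · simp [h0] at hL; omega
    · exact h0
  -- Otherwise each of the `p` consecutive blocks filling the period misses `n` by at least one,
  -- always in the same direction, and the total cannot be `n * p`.
  have hex : ∃ t, rights ω ((walk ω)^[t] v) (n + m) = n := by
    by_contra hne
    push Not at hne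
    rw [hL] at hp
    have hstep : ∀ k, rights ω v ((k + 1) * (n + m)) =
        rights ω v (k * (n + m)) + rights ω ((walk ω)^[k * (n + m)] v) (n + m) := fun k => by
      rw [← rights_add]; congr 1; ring
    rcases forall_lt_rights_or_forall_rights_lt ω v (n + m) n (p * (n + m)) fun t _ => hne t
      with h0 | h0
    · have : ∀ k ≤ p, n * k + k ≤ rights ω v (k * (n + m)) := by
        intro k hk
        induction k with
        | zero => simp
        | succ k ih =>
          have h1 := ih (by omega)
          have h2 := h0 (k * (n + m)) (Nat.mul_le_mul_right _ (by omega))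
          rw [hstep, mul_add n k 1]; omega
      have := this p le_rfl
      omega
    · have : ∀ k ≤ p, rights ω v (k * (n + m)) + k ≤ n * k := by
        intro k hk
        induction k with
        | zero => simp [rights]
        | succ k ih =>
          have h1 := ih (by omega)
          have h2 := h0 (k * (n + m)) (Nat.mul_le_mul_right _ (by omega))
          rw [hstep, mul_add n k 1]; omega
      have := this p le_rfl
      omega
  obtain ⟨t, ht⟩ := hex
  have h1 : IsPeriodicPt (walk ω) (n + m) ((walk ω)^[t] v) :=
    iterate_walk_eq_self_of_rights_eq ω _ ht
  have h2 := h1.minimalPeriod_dvd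
  rw [minimalPeriod_apply_iterate hv, hL] at h2
  have h3 := Nat.le_of_dvd (by omega) h2
  have hp1 : p = 1 := by nlinarith
  subst hp1
  rw [one_mul] at hL
  rw [hL] at hp hq
  exact ⟨hL, by linarith, by linarith⟩

theorem mem_periodicOrbit_iff_lt {α : Type*} {f : α → α} {x y : α} (hx : x ∈ periodicPts f) :
    y ∈ periodicOrbit f x ↔ ∃ i < minimalPeriod f x, f^[i] x = y := by
  rw [mem_periodicOrbit_iff hx]
  refine ⟨fun ⟨i, hi⟩ => ⟨i % minimalPeriod f x,
    Nat.mod_lt _ (minimalPeriod_pos_of_mem_periodicPts hx), ?_⟩, fun ⟨i, _, hi⟩ => ⟨i, hi⟩⟩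
  rw [iterate_mod_minimalPeriod_eq, hi]

theorem ncard_periodicOrbit_inter {α : Type*} {f : α → α} {x : α} (hx : x ∈ periodicPts f)
    (c : α → Prop) [DecidablePred c] :
    {y | y ∈ periodicOrbit f x ∧ c y}.ncard
      = ((Finset.range (minimalPeriod f x)).filter fun i => c (f^[i] x)).card := by
  have : {y | y ∈ periodicOrbit f x ∧ c y} = (fun i => f^[i] x) ''
      (((Finset.range (minimalPeriod f x)).filter fun i => c (f^[i] x) : Finset ℕ) : Set ℕ) := by
    ext y
    simp only [Set.mem_ofPred_eq, mem_periodicOrbit_iff_lt hx, Set.mem_image, Finset.coe_filter,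
      Finset.mem_range]
    constructor
    · rintro ⟨⟨i, hi, rfl⟩, hc⟩
      exact ⟨i, ⟨hi, hc⟩, rfl⟩
    · rintro ⟨i, ⟨hi, hc⟩, rfl⟩
      exact ⟨⟨i, hi, rfl⟩, hc⟩
  rw [this, Set.InjOn.ncard_image, Set.ncard_coe_finset]
  refine iterate_injOn_Iio_minimalPeriod.mono fun i hi => ?_
  simp only [Finset.coe_filter, Finset.mem_range, Set.mem_ofPred_eq] at hi
  exact hi.1

/-- The running count takes the values `0, …, N - 1` at the successive successes, hence each residue
once. For right or up steps this says that one turn crosses each line once. -/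
theorem card_filter_count_eq_one {N : ℕ} [NeZero N] (p : ℕ → Prop) [DecidablePred p] (L : ℕ)
    (hL : Nat.count p L = N) (s a : ZMod N) :
    ((Finset.range L).filter fun i => s + (Nat.count p i : ZMod N) = a ∧ p i).card = 1 := by
  have hr : (a - s).val < Nat.count p L := (ZMod.val_lt _).trans_eq hL.symm
  have hfin : ∀ hf : (Set.ofPred p).Finite, (a - s).val < hf.toFinset.card := fun hf =>
    hr.trans_le (Nat.count_le_card hf L)
  have hlt : ∀ i < L, p i → Nat.count p i < N := fun i hi hp =>
    (Nat.count_strict_mono hp hi).trans_eq hL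
  rw [Finset.card_eq_one]
  refine ⟨Nat.nth p (a - s).val, Finset.ext fun i => ?_⟩
  simp only [Finset.mem_filter, Finset.mem_range, Finset.mem_singleton]
  constructor
  · rintro ⟨hi, hs, hp⟩
    have h1 : (Nat.count p i : ZMod N) = a - s := by rw [← hs]; ring
    have h2 : Nat.count p i = (a - s).val := by
      rw [← h1, ZMod.val_natCast, Nat.mod_eq_of_lt (hlt i hi hp)]
    rw [← h2, Nat.nth_count hp]
  · rintro rfl
    refine ⟨Nat.nth_lt_of_lt_count hr, ?_, Nat.nth_mem _ hfin⟩
    rw [Nat.count_nth hfin, ZMod.natCast_zmod_val]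
    ring

theorem hasHomologyClass_one_one [NeZero n] [NeZero m] (ω : Config n m) (v : Torus n m)
    (hv : v ∈ periodicPts (walk ω)) (hL : minimalPeriod (walk ω) v = n + m)
    (hr : rights ω v (n + m) = n) (hu : ups ω v (n + m) = m) :
    HasHomologyClass ω {w | w ∈ periodicOrbit (walk ω) v} 1 1 := by
  constructor
  · intro a
    refine (ncard_periodicOrbit_inter hv fun u => u.1 = a ∧ ω u = true).trans ?_
    rw [hL]
    simp only [iterate_walk ω v]
    convert card_filter_count_eq_one (fun i => ω ((walk ω)^[i] v) = true) (n + m) hr v.1 a using 4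
    · rfl
    · rw [← iterate_walk]
  · intro b
    refine (ncard_periodicOrbit_inter hv fun u => u.2 = b ∧ ω u = false).trans ?_
    rw [hL]
    simp only [iterate_walk ω v]
    convert card_filter_count_eq_one (fun i => ω ((walk ω)^[i] v) = false) (n + m) hu v.2 b using 4
    · rfl
    · rw [← iterate_walk]

theorem minimalPeriod_of_hasHomologyClass [NeZero n] [NeZero m] (ω : Config n m) (v : Torus n m)
    (hv : v ∈ periodicPts (walk ω))
    (h : HasHomologyClass ω {w | w ∈ periodicOrbit (walk ω) v} 1 1) :
    minimalPeriod (walk ω) v = n + m ∧ rights ω v (n + m) = n ∧ ups ω v (n + m) = m := by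
  have h1 : rights ω v (minimalPeriod (walk ω) v) = n := by
    rw [rights, Nat.count_eq_card_filter_range,
      Finset.card_eq_sum_card_fiberwise (f := fun i => ((walk ω)^[i] v).1) (t := Finset.univ)
        fun _ _ => Finset.mem_coe.2 (Finset.mem_univ _)]
    have : ∀ a ∈ (Finset.univ : Finset (ZMod n)), (((Finset.range (minimalPeriod (walk ω) v)).filter
        fun i => ω ((walk ω)^[i] v) = true).filter fun i => ((walk ω)^[i] v).1 = a).card = 1 := by
      intro a _
      rw [← h.1 a, Finset.filter_filter]
      refine Eq.trans ?_ (ncard_periodicOrbit_inter hv fun u => u.1 = a ∧ ω u = true).symm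
      simp only [and_comm]
    rw [Finset.sum_congr rfl this]
    simp [ZMod.card]
  have h2 : ups ω v (minimalPeriod (walk ω) v) = m := by
    rw [ups, Nat.count_eq_card_filter_range,
      Finset.card_eq_sum_card_fiberwise (f := fun i => ((walk ω)^[i] v).2) (t := Finset.univ)
        fun _ _ => Finset.mem_coe.2 (Finset.mem_univ _)]
    have : ∀ a ∈ (Finset.univ : Finset (ZMod m)), (((Finset.range (minimalPeriod (walk ω) v)).filter
        fun i => ω ((walk ω)^[i] v) = false).filter fun i => ((walk ω)^[i] v).2 = a).card = 1 := by
      intro a _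
      rw [← h.2 a, Finset.filter_filter]
      refine Eq.trans ?_ (ncard_periodicOrbit_inter hv fun u => u.2 = a ∧ ω u = false).symm
      simp only [and_comm]
    rw [Finset.sum_congr rfl this]
    simp [ZMod.card]
  have h3 := rights_add_ups ω v (minimalPeriod (walk ω) v)
  have h4 : minimalPeriod (walk ω) v = n + m := by omega
  rw [h4] at h1 h2
  exact ⟨h4, h1, h2⟩

end Orbits

/-! ### The law of the configuration and the cost of a self-avoiding path -/

section Law

open Function

variable {n m : ℕ}

instance : IsProbabilityMeasure (law n m) := by unfold law; infer_instance

theorem law_real_cylinder (U : Finset (Torus n m)) (ω₀ : Config n m) :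
    (law n m).real {ω | ∀ u ∈ U, ω u = ω₀ u} = (1 / 2) ^ U.card := by
  have h : {ω : Config n m | ∀ u ∈ U, ω u = ω₀ u} = Set.pi (U : Set (Torus n m)) fun u => {ω₀ u} := by
    ext ω; simp [Set.mem_pi]
  rw [h, Measure.real, law, Measure.infinitePi_pi _ fun _ _ => MeasurableSet.singleton _]
  simp

theorem law_real_le_of_agree (U : Finset (Torus n m)) (E : Set (Config n m))
    (h : ∀ ω ∈ E, ∀ ω' ∈ E, ∀ u ∈ U, ω u = ω' u) : (law n m).real E ≤ (1 / 2) ^ U.card := by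
  rcases E.eq_empty_or_nonempty with rfl | ⟨ω₀, h₀⟩
  · simp
  · rw [← law_real_cylinder U ω₀]
    exact measureReal_mono fun ω hω u hu => h ω hω ω₀ h₀ u hu

theorem law_real_eq_sum [NeZero n] [NeZero m] (E : Set (Config n m)) [DecidablePred (· ∈ E)] :
    (law n m).real E = ∑ ω : Config n m, if ω ∈ E then (1 / 2) ^ Fintype.card (Torus n m) else 0 := by
  have h1 : ∀ ω : Config n m, (law n m).real {ω} = (1 / 2) ^ Fintype.card (Torus n m) := by
    intro ω
    rw [← Finset.card_univ, ← law_real_cylinder Finset.univ ω]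
    congr 1
    ext ω'
    simp [funext_iff]
  have h2 : E = ((Finset.univ.filter (· ∈ E) : Finset (Config n m)) : Set (Config n m)) := by
    ext; simp
  conv_lhs => rw [h2]
  rw [← sum_measureReal_singleton, ← Finset.sum_filter]
  exact Finset.sum_congr rfl fun ω _ => h1 ω

/-- The times before `T` at which the orbit of `v` makes a right step. -/
def word (ω : Config n m) (v : Torus n m) (T : ℕ) : Finset ℕ :=
  (Finset.range T).filter fun i => ω ((walk ω)^[i] v) = true

theorem mem_word {ω : Config n m} {v : Torus n m} {T i : ℕ} :
    i ∈ word ω v T ↔ i < T ∧ ω ((walk ω)^[i] v) = true := by simp [word]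

theorem card_word (ω : Config n m) (v : Torus n m) (T : ℕ) : (word ω v T).card = rights ω v T := by
  rw [rights, Nat.count_eq_card_filter_range, word]

theorem apply_iterate_eq_of_word_eq {ω ω' : Config n m} {v : Torus n m} {T : ℕ}
    (h : word ω v T = word ω' v T) {i : ℕ} (hi : i < T) :
    ω ((walk ω)^[i] v) = ω' ((walk ω')^[i] v) := by
  have := Finset.ext_iff.1 h i
  simp only [mem_word, hi, true_and] at this
  exact Bool.eq_iff_iff.2 this

theorem iterate_eq_of_word_eq {ω ω' : Config n m} {v : Torus n m} {T : ℕ}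
    (h : word ω v T = word ω' v T) {i : ℕ} (hi : i ≤ T) :
    (walk ω)^[i] v = (walk ω')^[i] v := by
  induction i with
  | zero => rfl
  | succ i ih =>
    have h1 := ih (by omega)
    have h2 := apply_iterate_eq_of_word_eq h (i := i) (by omega)
    rw [iterate_succ_apply', iterate_succ_apply', walk, walk, ← h2, h1]

/-- The start and the word determine the path; injectivity makes its first `T` vertices distinct, so
fixing the word fixes `T` independent coins. This stands in for the independence of the steps. -/
theorem law_real_word_mem_le (v : Torus n m) (T : ℕ) (S : Finset (Finset ℕ)) :
    (law n m).real {ω | Set.InjOn (fun i => (walk ω)^[i] v) (Set.Iio T) ∧ word ω v T ∈ S}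
      ≤ S.card * (1 / 2) ^ T := by
  classical
  have h1 : {ω : Config n m | Set.InjOn (fun i => (walk ω)^[i] v) (Set.Iio T) ∧ word ω v T ∈ S}
      ⊆ ⋃ s ∈ S, {ω | Set.InjOn (fun i => (walk ω)^[i] v) (Set.Iio T) ∧ word ω v T = s} := by
    rintro ω ⟨h, hs⟩
    simp only [Set.mem_iUnion]
    exact ⟨_, hs, h, rfl⟩
  refine (measureReal_mono h1 (measure_ne_top _ _)).trans ((measureReal_biUnion_finset_le _ _).trans ?_)
  rw [← nsmul_eq_mul]
  refine Finset.sum_le_card_nsmul _ _ _ fun s _ => ?_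
  set E := {ω : Config n m | Set.InjOn (fun i => (walk ω)^[i] v) (Set.Iio T) ∧ word ω v T = s}
    with hE
  rcases E.eq_empty_or_nonempty with h0 | ⟨ω₀, h₀, h₀'⟩
  · rw [h0]; simp
  · have hc : ((Finset.range T).image fun i => (walk ω₀)^[i] v).card = T := by
      rw [Finset.card_image_of_injOn (by simpa using h₀), Finset.card_range]
    rw [← hc]
    have key : ∀ ω ∈ E, ∀ u ∈ (Finset.range T).image fun i => (walk ω₀)^[i] v, ω u = ω₀ u := by
      rintro ω ⟨_, hs⟩ u hu
      obtain ⟨i, hi, rfl⟩ := Finset.mem_image.1 hu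
      rw [Finset.mem_range] at hi
      have hw : word ω v T = word ω₀ v T := hs.trans h₀'.symm
      have := apply_iterate_eq_of_word_eq hw hi
      rwa [iterate_eq_of_word_eq hw hi.le] at this
    exact law_real_le_of_agree _ _ fun ω hω ω' hω' u hu => (key ω hω u hu).trans (key ω' hω' u hu).symm

end Law

/-! ### Long self-avoiding orbits -/

section Blocks

/-- The `j`-th block of length `W` of a set of integers. -/
def block (W : ℕ) (A : Finset ℕ) (j : ℕ) : Finset ℕ :=
  (Finset.range W).filter fun i => j * W + i ∈ A

theorem card_filter_block_le (W J : ℕ) (P : Finset ℕ → Prop) [DecidablePred P] :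
    ((Finset.range (J * W)).powerset.filter fun A => ∀ j < J, P (block W A j)).card
      ≤ ((Finset.range W).powerset.filter P).card ^ J := by
  classical
  have h1 : (Fintype.piFinset fun _ : Fin J => (Finset.range W).powerset.filter P).card
      = ((Finset.range W).powerset.filter P).card ^ J := by
    rw [Fintype.card_piFinset]; simp
  rw [← h1]
  refine Finset.card_le_card_of_injOn (fun A (j : Fin J) => block W A j) ?_ ?_
  · intro A hA
    simp only [Finset.coe_filter, Finset.mem_powerset, Set.mem_ofPred_eq] at hA
    simp only [Finset.mem_coe, Fintype.mem_piFinset, Finset.mem_filter, Finset.mem_powerset]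
    exact fun j => ⟨Finset.filter_subset _ _, hA.2 j j.2⟩
  · intro A hA B hB hAB
    simp only [Finset.coe_filter, Finset.mem_powerset, Set.mem_ofPred_eq] at hA hB
    have key : ∀ A B : Finset ℕ, A ⊆ Finset.range (J * W) →
        (∀ j : Fin J, block W A j = block W B j) → A ⊆ B := by
      intro A B hA h i hi
      have hi' := Finset.mem_range.1 (hA hi)
      have hW : 0 < W := Nat.pos_of_ne_zero fun h0 => by simp [h0] at hi'
      have hj : i / W < J := (Nat.div_lt_iff_lt_mul hW).2 hi'
      have h1 : i % W ∈ block W A (i / W) := by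
        simp only [block, Finset.mem_filter, Finset.mem_range]
        refine ⟨Nat.mod_lt _ hW, ?_⟩
        rwa [Nat.div_add_mod']
      rw [h ⟨i / W, hj⟩] at h1
      simp only [block, Finset.mem_filter, Nat.div_add_mod'] at h1
      exact h1.2
    exact (key A B hA.1 (congr_fun hAB)).antisymm (key B A hB.1 fun j => (congr_fun hAB j).symm)

theorem card_powerset_filter_card_le (W n : ℕ) :
    ((Finset.range W).powerset.filter fun B => B.card ≤ n).card
      = ∑ j ∈ Finset.range (n + 1), W.choose j := by
  rw [Finset.card_eq_sum_card_fiberwise (f := Finset.card) (t := Finset.range (n + 1))]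
  · refine Finset.sum_congr rfl fun j hj => ?_
    rw [Finset.mem_range] at hj
    rw [Finset.filter_filter]
    have : ((Finset.range W).powerset.filter fun B => B.card ≤ n ∧ B.card = j)
        = (Finset.range W).powersetCard j := by
      ext B
      simp only [Finset.mem_filter, Finset.mem_powerset, Finset.mem_powersetCard]
      refine and_congr_right fun _ => ⟨fun h => h.2, fun h => ⟨by omega, h⟩⟩
    rw [this, Finset.card_powersetCard, Finset.card_range]
  · intro B hB
    simp only [Finset.coe_filter, Set.mem_ofPred_eq] at hB
    simp only [Finset.coe_range, Set.mem_Iio]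
    omega

theorem card_powerset_filter_lt_card_le (n m : ℕ) (δ : ℝ)
    (hδ : δ * 2 ^ (n + m) ≤ ∑ j ∈ Finset.range (n + 1), ((n + m).choose j : ℝ)) :
    (((Finset.range (n + m)).powerset.filter fun B => n < B.card).card : ℝ)
      ≤ (1 - δ) * 2 ^ (n + m) := by
  have h1 := Finset.card_filter_add_card_filter_not (s := (Finset.range (n + m)).powerset)
    fun B => B.card ≤ n
  rw [card_powerset_filter_card_le, Finset.card_powerset, Finset.card_range] at h1
  simp only [not_le] at h1
  have h2 : ∑ j ∈ Finset.range (n + 1), ((n + m).choose j : ℝ)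
    + (((Finset.range (n + m)).powerset.filter fun B => n < B.card).card : ℝ) = 2 ^ (n + m) := by
    exact_mod_cast h1
  linarith

/-- Complementation turns fewer than `n` elements into more than `m ≥ n`. Thus a single `δ` serves
both sides of `n`. -/
theorem card_powerset_filter_card_lt_le (n m : ℕ) (hnm : n ≤ m) :
    ((Finset.range (n + m)).powerset.filter fun B => B.card < n).card
      ≤ ((Finset.range (n + m)).powerset.filter fun B => n < B.card).card := by
  refine Finset.card_le_card_of_injOn (fun B => Finset.range (n + m) \ B) ?_ ?_
  · intro B hB
    simp only [Finset.coe_filter, Finset.mem_powerset, Set.mem_ofPred_eq] at hB ⊢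
    refine ⟨Finset.sdiff_subset, ?_⟩
    rw [Finset.card_sdiff_of_subset hB.1, Finset.card_range]
    omega
  · intro A hA B hB h
    simp only [Finset.coe_filter, Finset.mem_powerset, Set.mem_ofPred_eq] at hA hB
    have h' : Finset.range (n + m) \ A = Finset.range (n + m) \ B := h
    rw [← Finset.sdiff_sdiff_eq_self hA.1, h', Finset.sdiff_sdiff_eq_self hB.1]

variable {n m : ℕ}

theorem card_block_word (ω : Config n m) (v : Torus n m) (W J j : ℕ) (hj : j < J) :
    (block W (word ω v (J * W)) j).card = rights ω ((walk ω)^[j * W] v) W := by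
  rw [← card_word]
  congr 1
  ext i
  simp only [block, Finset.mem_filter, Finset.mem_range, mem_word]
  refine and_congr_right fun hi => ?_
  rw [← Function.iterate_add_apply, add_comm i]
  refine and_iff_right ?_
  calc j * W + i < (j + 1) * W := by rw [add_mul]; omega
    _ ≤ J * W := Nat.mul_le_mul_right _ hj

/-- A self-avoiding orbit stays on one side of its translates by one turn around the torus, which
has exponentially small probability in the number of turns. -/
theorem law_real_injOn_le [NeZero n] (hnm : n ≤ m) (v : Torus n m) (J : ℕ) (δ : ℝ)
    (hδ : δ * 2 ^ (n + m) ≤ ∑ j ∈ Finset.range (n + 1), ((n + m).choose j : ℝ)) :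
    (law n m).real {ω | Set.InjOn (fun i => (walk ω)^[i] v) (Set.Iic (J * (n + m)))}
      ≤ 2 * (1 - δ) ^ J := by
  classical
  -- Cutting a word into its `J` blocks is injective, so the count of admissible words is at most a
  -- `J`-th power; stated for a general condition to serve for both sides of `n`.
  have hsub : ∀ (P : Finset ℕ → Prop) (Q : ℕ → Prop) [DecidablePred P], (∀ B, P B ↔ Q B.card) →
      (((Finset.range (n + m)).powerset.filter P).card : ℝ) ≤ (1 - δ) * 2 ^ (n + m) →
      (law n m).real {ω | Set.InjOn (fun i => (walk ω)^[i] v) (Set.Iio (J * (n + m))) ∧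
        ∀ j < J, Q (rights ω ((walk ω)^[j * (n + m)] v) (n + m))} ≤ (1 - δ) ^ J := by
    intro P Q _ hPQ hcard
    have h1 : {ω : Config n m | Set.InjOn (fun i => (walk ω)^[i] v) (Set.Iio (J * (n + m))) ∧
        ∀ j < J, Q (rights ω ((walk ω)^[j * (n + m)] v) (n + m))} ⊆
        {ω | Set.InjOn (fun i => (walk ω)^[i] v) (Set.Iio (J * (n + m))) ∧
          word ω v (J * (n + m)) ∈ (Finset.range (J * (n + m))).powerset.filter
            fun A => ∀ j < J, P (block (n + m) A j)} := by
      rintro ω ⟨h, hQ⟩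
      refine ⟨h, Finset.mem_filter.2 ⟨Finset.mem_powerset.2 (Finset.filter_subset _ _), ?_⟩⟩
      intro j hj
      rw [hPQ, card_block_word ω v _ J j hj]
      exact hQ j hj
    refine (measureReal_mono h1).trans ((law_real_word_mem_le _ _ _).trans ?_)
    have h2 : (((Finset.range (J * (n + m))).powerset.filter
            fun A => ∀ j < J, P (block (n + m) A j)).card : ℝ) ≤ ((1 - δ) * 2 ^ (n + m)) ^ J := by
      refine le_trans (by exact_mod_cast card_filter_block_le (n + m) J P)
        (pow_le_pow_left₀ (by positivity) hcard J)
    refine (mul_le_mul_of_nonneg_right h2 (by positivity)).trans_eq ?_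
    rw [mul_pow, mul_assoc, ← pow_mul, mul_comm J, ← mul_pow]
    norm_num
  have hgt := card_powerset_filter_lt_card_le n m δ hδ
  have hlt := le_trans (Nat.cast_le.2 (card_powerset_filter_card_lt_le n m hnm)) hgt
  have hu : {ω : Config n m | Set.InjOn (fun i => (walk ω)^[i] v) (Set.Iic (J * (n + m)))} ⊆
      {ω | Set.InjOn (fun i => (walk ω)^[i] v) (Set.Iio (J * (n + m))) ∧
        ∀ j < J, n < (rights ω ((walk ω)^[j * (n + m)] v) (n + m))} ∪
      {ω | Set.InjOn (fun i => (walk ω)^[i] v) (Set.Iio (J * (n + m))) ∧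
        ∀ j < J, (rights ω ((walk ω)^[j * (n + m)] v) (n + m)) < n} := by
    intro ω hω
    have h0 : Set.InjOn (fun i => (walk ω)^[i] v) (Set.Iio (J * (n + m))) :=
      hω.mono Set.Iio_subset_Iic_self
    exact (forall_block_of_injOn ω v J hω).imp (fun h => ⟨h0, h⟩) fun h => ⟨h0, h⟩
  refine (measureReal_mono hu).trans ((measureReal_union_le _ _).trans ?_)
  have h1 := hsub (fun B => n < B.card) (fun k => n < k) (fun _ => Iff.rfl) hgt
  have h2 := hsub (fun B => B.card < n) (fun k => k < n) (fun _ => Iff.rfl) hlt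
  linarith

end Blocks

/-! ### Closed orbits off the diagonal: a union bound -/

section BadEvent

open Function

variable {n m : ℕ}

/-- The configurations having a closed orbit whose homology class is not on the diagonal. -/
def offDiagonal (n m : ℕ) : Set (Config n m) :=
  {ω | ∃ v ∈ periodicPts (walk ω),
    n * ups ω v (minimalPeriod (walk ω) v) ≠ m * rights ω v (minimalPeriod (walk ω) v)}

theorem law_real_injOn_rights_le (v : Torus n m) (p q : ℕ) (h : 1 ≤ p * n + q * m) :
    (law n m).real {ω | Set.InjOn (fun i => (walk ω)^[i] v) (Set.Iio (p * n + q * m)) ∧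
        rights ω v (p * n + q * m) = p * n}
      ≤ Real.exp (-(((p * n : ℝ) - q * m) ^ 2 / (2 * (p * n + q * m)))) := by
  have h1 : {ω : Config n m | Set.InjOn (fun i => (walk ω)^[i] v) (Set.Iio (p * n + q * m)) ∧
        rights ω v (p * n + q * m) = p * n} ⊆
      {ω | Set.InjOn (fun i => (walk ω)^[i] v) (Set.Iio (p * n + q * m)) ∧
        word ω v (p * n + q * m) ∈ (Finset.range (p * n + q * m)).powersetCard (p * n)} :=
    fun ω hω => ⟨hω.1, Finset.mem_powersetCard.2 ⟨Finset.filter_subset _ _,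
      (card_word _ _ _).trans hω.2⟩⟩
  refine (measureReal_mono h1).trans ((law_real_word_mem_le _ _ _).trans ?_)
  rw [Finset.card_powersetCard, Finset.card_range]
  have h2 := choose_le_two_pow_mul_exp (p * n + q * m) (p * n) h
  push_cast at h2
  have h3 : (2 * (p * n : ℝ) - (p * n + q * m)) = p * n - q * m := by ring
  rw [h3] at h2
  refine (mul_le_mul_of_nonneg_right h2 (by positivity)).trans_eq ?_
  rw [mul_right_comm, ← mul_pow]
  norm_num

theorem law_real_offDiagonal_le [NeZero n] [NeZero m] (hnm : n ≤ m) (hm : m ≤ 2 * n) (J : ℕ)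
    (δ e : ℝ) (hδ : δ * 2 ^ (n + m) ≤ ∑ j ∈ Finset.range (n + 1), ((n + m).choose j : ℝ))
    (he0 : 0 ≤ e) (he : ∀ p q : ℕ, p ≠ q → p + q ≤ 3 * J →
      Real.exp (-(((p * n : ℝ) - q * m) ^ 2 / (2 * (p * n + q * m)))) ≤ e) :
    (law n m).real (offDiagonal n m)
      ≤ (n * m : ℝ) * (2 * (1 - δ) ^ J + (3 * J + 1) ^ 2 * e) := by
  classical
  have hn : 0 < n := Nat.pos_of_neZero n
  have hm0 : 0 < m := Nat.pos_of_neZero m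
  set PQ := (Finset.range (3 * J + 1) ×ˢ Finset.range (3 * J + 1)).filter
    fun x => x.1 ≠ x.2 ∧ x.1 + x.2 ≤ 3 * J with hPQ
  have hsub : offDiagonal n m ⊆ ⋃ v ∈ (Finset.univ : Finset (Torus n m)),
      ({ω | Set.InjOn (fun i => (walk ω)^[i] v) (Set.Iic (J * (n + m)))} ∪
        ⋃ x ∈ PQ, {ω | Set.InjOn (fun i => (walk ω)^[i] v) (Set.Iio (x.1 * n + x.2 * m)) ∧
          rights ω v (x.1 * n + x.2 * m) = x.1 * n}) := by
    rintro ω ⟨v, hv, hne⟩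
    simp only [Set.mem_iUnion]
    refine ⟨v, Finset.mem_univ _, ?_⟩
    have hinj := iterate_injOn_Iio_minimalPeriod (f := walk ω) (x := v)
    have hadd := rights_add_ups ω v (minimalPeriod (walk ω) v)
    have hfix : (walk ω)^[minimalPeriod (walk ω) v] v = v := iterate_minimalPeriod
    rw [iterate_walk, Prod.ext_iff] at hfix
    simp only [add_eq_left, ZMod.natCast_eq_zero_iff] at hfix
    obtain ⟨⟨p, hp⟩, q, hq⟩ := hfix
    rcases Nat.lt_or_ge (J * (n + m)) (minimalPeriod (walk ω) v) with h | h
    · exact Or.inl (hinj.mono fun i hi => lt_of_le_of_lt hi h)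
    · refine Or.inr ?_
      simp only [Set.mem_iUnion]
      have hL : minimalPeriod (walk ω) v = p * n + q * m := by rw [← hadd, hp, hq]; ring
      -- From `(p + q) * n ≤ p * n + q * m ≤ J * (n + m) ≤ 3 * J * n`, using `n ≤ m ≤ 2 * n`.
      have hsum : p + q ≤ 3 * J := by
        rw [hL] at h
        have h1 : (p + q) * n ≤ 3 * J * n := by nlinarith
        exact Nat.le_of_mul_le_mul_right h1 hn
      refine ⟨(p, q), ?_, ?_⟩
      · simp only [hPQ, Finset.mem_filter, Finset.mem_product, Finset.mem_range]
        refine ⟨⟨by omega, by omega⟩, fun hpq => hne ?_, hsum⟩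
        rw [hp, hq, hpq]; ring
      · rw [← hL]
        exact ⟨hinj, by rw [hp]; ring⟩
  refine (measureReal_mono hsub (measure_ne_top _ _)).trans
    ((measureReal_biUnion_finset_le _ _).trans ?_)
  have hcard : ((Finset.univ : Finset (Torus n m)).card : ℝ) = n * m := by
    rw [Finset.card_univ, Fintype.card_prod, ZMod.card, ZMod.card]; push_cast; rfl
  rw [← hcard, ← nsmul_eq_mul]
  refine Finset.sum_le_card_nsmul _ _ _ fun v _ => ?_
  refine (measureReal_union_le _ _).trans (add_le_add (law_real_injOn_le hnm v J δ hδ) ?_)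
  refine (measureReal_biUnion_finset_le _ _).trans ?_
  have h1 : ∀ x ∈ PQ, (law n m).real
      {ω | Set.InjOn (fun i => (walk ω)^[i] v) (Set.Iio (x.1 * n + x.2 * m)) ∧
          rights ω v (x.1 * n + x.2 * m) = x.1 * n} ≤ e := by
    intro x hx
    simp only [hPQ, Finset.mem_filter, Finset.mem_product, Finset.mem_range] at hx
    refine (law_real_injOn_rights_le v x.1 x.2 ?_).trans (he x.1 x.2 hx.2.1 hx.2.2)
    by_contra h0
    have h2 : x.1 * n + x.2 * m = 0 := by omega
    simp only [Nat.add_eq_zero_iff, Nat.mul_eq_zero] at h2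
    have := hx.2.1
    omega
  refine (Finset.sum_le_card_nsmul _ _ _ h1).trans ?_
  rw [nsmul_eq_mul]
  have hc : (PQ.card : ℝ) ≤ (3 * J + 1) ^ 2 := by
    have := Finset.card_filter_le (Finset.range (3 * J + 1) ×ˢ Finset.range (3 * J + 1))
      fun x => x.1 ≠ x.2 ∧ x.1 + x.2 ≤ 3 * J
    rw [Finset.card_product, Finset.card_range, ← sq] at this
    exact_mod_cast this
  exact mul_le_mul_of_nonneg_right hc he0

theorem isClosedOrbit_of_notMem_offDiagonal [NeZero n] [NeZero m] {ω : Config n m}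
    (h : ω ∉ offDiagonal n m) {v : Torus n m} (hv : v ∈ periodicPts (walk ω)) :
    minimalPeriod (walk ω) v = n + m ∧
      HasHomologyClass ω {w | w ∈ periodicOrbit (walk ω) v} 1 1 := by
  have h1 : n * ups ω v (minimalPeriod (walk ω) v) = m * rights ω v (minimalPeriod (walk ω) v) := by
    by_contra h1
    exact h ⟨v, hv, h1⟩
  obtain ⟨h2, h3, h4⟩ := minimalPeriod_of_ups_eq ω v hv h1
  exact ⟨h2, hasHomologyClass_one_one ω v hv h2 h3 h4⟩

end BadEvent

/-! ### Upper tail: factorial-type moments of the number of cycles -/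

section UpperTail

open Function

variable {n m : ℕ}

open Classical in
/-- The ordinates at which a closed orbit of homology class `(1, 1)` makes its right step from
the vertical axis. -/
noncomputable def exits [NeZero m] (ω : Config n m) : Finset (ZMod m) :=
  Finset.univ.filter fun y => ((0, y) : Torus n m) ∈ periodicPts (walk ω) ∧ ω (0, y) = true ∧
    HasHomologyClass ω {w | w ∈ periodicOrbit (walk ω) (0, y)} 1 1

theorem mem_exits [NeZero m] {ω : Config n m} {y : ZMod m} :
    y ∈ exits ω ↔ ((0, y) : Torus n m) ∈ periodicPts (walk ω) ∧ ω (0, y) = true ∧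
    HasHomologyClass ω {w | w ∈ periodicOrbit (walk ω) (0, y)} 1 1 := by
  simp [exits]

theorem numCycles_le_card_exits [NeZero m] (ω : Config n m) :
    numCycles 1 1 ω ≤ (exits ω).card := by
  rw [← Set.ncard_coe_finset]
  refine le_trans ?_ (Set.ncard_image_le (f := fun y => {w | w ∈ periodicOrbit (walk ω) (0, y)})
    (exits ω).finite_toSet)
  refine Set.ncard_le_ncard ?_ ((exits ω).finite_toSet.image _)
  rintro C ⟨⟨v, hv, rfl⟩, hC⟩
  have h1 : {u | u ∈ {w | w ∈ periodicOrbit (walk ω) v} ∧ u.1 = 0 ∧ ω u = true}.Nonempty := by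
    refine Set.nonempty_of_ncard_ne_zero ?_
    rw [hC.1 0]
    exact one_ne_zero
  obtain ⟨⟨x, y⟩, hu, hx, ht⟩ := h1
  simp only at hx
  subst hx
  obtain ⟨i, hi⟩ := (mem_periodicOrbit_iff hv).1 hu
  have ho : periodicOrbit (walk ω) (0, y) = periodicOrbit (walk ω) v := by
    rw [← hi, periodicOrbit_apply_iterate_eq hv]
  refine ⟨y, ?_, by simp only [ho]⟩
  rw [Finset.mem_coe, mem_exits, ho, ← hi]
  refine ⟨?_, by rw [hi]; exact ht, hC⟩
  obtain ⟨k, hk, hk'⟩ := hv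
  exact ⟨k, hk, hk'.apply_iterate i⟩

/-- A cycle of class `(1, 1)` has only one right step from the axis `x = 0`; so cycles issued from
distinct exits are disjoint. -/
theorem eq_of_mem_exits [NeZero m] {ω : Config n m} {y y' : ZMod m} (hy : y ∈ exits ω)
    (hy' : y' ∈ exits ω) {i j : ℕ} (h : (walk ω)^[i] (0, y) = (walk ω)^[j] (0, y')) : y = y' := by
  rw [mem_exits] at hy hy'
  have ho : periodicOrbit (walk ω) ((0, y) : Torus n m) = periodicOrbit (walk ω) (0, y') := by
    rw [← periodicOrbit_apply_iterate_eq hy.1 i, h, periodicOrbit_apply_iterate_eq hy'.1]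
  obtain ⟨a, ha⟩ := Set.ncard_eq_one.1 (hy.2.2.1 0)
  have h1 : ((0, y) : Torus n m) ∈ ({a} : Set (Torus n m)) := by
    rw [← ha]; exact ⟨self_mem_periodicOrbit hy.1, rfl, hy.2.1⟩
  have h2 : ((0, y') : Torus n m) ∈ ({a} : Set (Torus n m)) := by
    rw [← ha]
    refine ⟨?_, rfl, hy'.2.1⟩
    change _ ∈ periodicOrbit _ _
    rw [ho]; exact self_mem_periodicOrbit hy'.1
  rw [Set.mem_singleton_iff] at h1 h2
  exact congr_arg Prod.snd (h1.trans h2.symm)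

/-- Each exit in `B` has one of `(n + m).choose n` words. Once the words are chosen, the cycles are
disjoint and fix `(n + m) * B.card` distinct coins. -/
theorem law_real_subset_exits_le [NeZero n] [NeZero m] (B : Finset (ZMod m)) :
    (law n m).real {ω | B ⊆ exits ω} ≤ ((n + m).choose n * (1 / 2) ^ (n + m)) ^ B.card := by
  classical
  set S := (Finset.range (n + m)).powersetCard n with hS
  have hrw : ∀ {ω : Config n m} {y : ZMod m}, y ∈ exits ω →
      minimalPeriod (walk ω) (0, y) = n + m ∧ rights ω (0, y) (n + m) = n := by
    intro ω y hy
    rw [mem_exits] at hy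
    have := minimalPeriod_of_hasHomologyClass ω _ hy.1 hy.2.2
    exact ⟨this.1, this.2.1⟩
  have hsub : {ω : Config n m | B ⊆ exits ω} ⊆ ⋃ f ∈ Fintype.piFinset (fun _ : B => S),
      {ω | B ⊆ exits ω ∧ ∀ y : B, word ω (0, (y : ZMod m)) (n + m) = f y} := by
    intro ω hω
    simp only [Set.mem_iUnion]
    refine ⟨fun y => word ω (0, (y : ZMod m)) (n + m), Fintype.mem_piFinset.2 fun y => ?_, hω,
      fun y => rfl⟩
    rw [hS, Finset.mem_powersetCard]
    exact ⟨Finset.filter_subset _ _, (card_word _ _ _).trans (hrw (hω y.2)).2⟩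
  refine (measureReal_mono hsub (measure_ne_top _ _)).trans
    ((measureReal_biUnion_finset_le _ _).trans ?_)
  have hcard : ((Fintype.piFinset (fun _ : B => S)).card : ℝ) = ((n + m).choose n : ℝ) ^ B.card := by
    rw [Fintype.card_piFinset]
    simp [hS]
  rw [mul_pow, ← hcard, ← nsmul_eq_mul]
  refine Finset.sum_le_card_nsmul _ _ _ fun f _ => ?_
  set E := {ω : Config n m | B ⊆ exits ω ∧ ∀ y : B, word ω (0, (y : ZMod m)) (n + m) = f y} with hE
  rcases E.eq_empty_or_nonempty with h0 | ⟨ω₀, h₀, h₀'⟩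
  · rw [h0]; simp
  set U : Finset (Torus n m) :=
    B.biUnion fun y => (Finset.range (n + m)).image fun i => (walk ω₀)^[i] (0, y) with hU
  have hUc : U.card = (n + m) * B.card := by
    rw [hU, Finset.card_biUnion]
    · rw [Finset.sum_congr rfl (g := fun _ => n + m)]
      · simp [mul_comm]
      · intro y hy
        rw [Finset.card_image_of_injOn, Finset.card_range]
        rw [Finset.coe_range, ← (hrw (h₀ hy)).1]
        exact iterate_injOn_Iio_minimalPeriod
    · intro y hy y' hy' hne
      refine Finset.disjoint_left.2 ?_
      intro u hu hu'
      obtain ⟨i, _, rfl⟩ := Finset.mem_image.1 hu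
      obtain ⟨j, _, h⟩ := Finset.mem_image.1 hu'
      exact hne (eq_of_mem_exits (h₀ hy) (h₀ hy') h.symm)
  rw [← pow_mul, ← hUc]
  have key : ∀ ω ∈ E, ∀ u ∈ U, ω u = ω₀ u := by
    rintro ω ⟨_, hs⟩ u hu
    obtain ⟨y, hy, hu⟩ := Finset.mem_biUnion.1 hu
    obtain ⟨i, hi, rfl⟩ := Finset.mem_image.1 hu
    rw [Finset.mem_range] at hi
    have hw : word ω (0, y) (n + m) = word ω₀ (0, y) (n + m) :=
      (hs ⟨y, hy⟩).trans (h₀' ⟨y, hy⟩).symm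
    have := apply_iterate_eq_of_word_eq hw hi
    rwa [iterate_eq_of_word_eq hw hi.le] at this
  exact law_real_le_of_agree _ _ fun ω hω ω' hω' u hu => (key ω hω u hu).trans (key ω' hω' u hu).symm

theorem law_real_lt_numCycles_le [NeZero n] [NeZero m] (x : ℝ) :
    (law n m).real {ω | x < (numCycles 1 1 ω : ℝ)}
      ≤ Real.exp (m * ((n + m).choose n * (1 / 2) ^ (n + m)) - x * Real.log 2) := by
  classical
  set q : ℝ := (n + m).choose n * (1 / 2) ^ (n + m) with hq
  have hq0 : 0 ≤ q := by positivity
  set κ : ℝ := (1 / 2) ^ Fintype.card (Torus n m) with hκ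
  have hκ0 : 0 ≤ κ := by positivity
  have hpow : ∀ k : ℕ, x < k → Real.exp (x * Real.log 2) ≤ 2 ^ k := by
    intro k hk
    have : (2 : ℝ) ^ k = Real.exp (k * Real.log 2) := by
      rw [Real.exp_nat_mul, Real.exp_log (by norm_num)]
    rw [this, Real.exp_le_exp]
    exact mul_le_mul_of_nonneg_right hk.le (Real.log_nonneg (by norm_num))
  have h1 : Real.exp (x * Real.log 2) * (law n m).real {ω | x < (numCycles 1 1 ω : ℝ)}
      ≤ ∑ ω : Config n m, κ * 2 ^ (exits ω).card := by
    rw [law_real_eq_sum, Finset.mul_sum]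
    refine Finset.sum_le_sum fun ω _ => ?_
    split_ifs with h
    · rw [mul_comm]
      refine mul_le_mul_of_nonneg_left ((hpow _ h).trans ?_) hκ0
      exact pow_le_pow_right₀ (by norm_num) (numCycles_le_card_exits ω)
    · rw [mul_zero]; positivity
  -- Since `2 ^ (exits ω).card` counts the subsets of `exits ω`, its mean is a sum of inclusion
  -- probabilities.
  have h2 : ∑ ω : Config n m, κ * 2 ^ (exits ω).card
      = ∑ B : Finset (ZMod m), (law n m).real {ω | B ⊆ exits ω} := by
    simp only [law_real_eq_sum]
    rw [Finset.sum_comm]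
    refine Finset.sum_congr rfl fun ω _ => ?_
    rw [← Finset.sum_filter, Finset.sum_const, nsmul_eq_mul, mul_comm]
    congr 1
    have h3 : (Finset.univ.filter fun B : Finset (ZMod m) => ω ∈ {ω | B ⊆ exits ω})
      = (exits ω).powerset := by ext B; simp
    rw [h3, Finset.card_powerset]
    push_cast; rfl
  have h3 : ∑ B : Finset (ZMod m), (law n m).real {ω | B ⊆ exits ω} ≤ (q + 1) ^ m := by
    have := Finset.sum_pow_mul_eq_add_pow q 1 (Finset.univ : Finset (ZMod m))
    rw [Finset.card_univ, ZMod.card] at this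
    rw [← this, Finset.powerset_univ]
    refine Finset.sum_le_sum fun B _ => ?_
    rw [one_pow, mul_one]
    exact law_real_subset_exits_le B
  have h4 : (q + 1) ^ m ≤ Real.exp (m * q) := by
    rw [Real.exp_nat_mul]
    exact pow_le_pow_left₀ (by positivity) (Real.add_one_le_exp q) m
  rw [Real.exp_sub, le_div_iff₀ (Real.exp_pos _), mul_comm]
  exact h1.trans (h2.trans_le (h3.trans h4))

end UpperTail

/-! ### Lower tail: the expected characteristic determinant -/

section LowerTail

open Function

/-- The transition matrix of a self-map. -/
def mapMatrix {V : Type*} [DecidableEq V] (f : V → V) : Matrix V V ℝ :=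
  Matrix.of fun v w => if f v = w then 1 else 0

section MapMatrix

variable {V : Type*} [Fintype V] [DecidableEq V]

theorem mapMatrix_mul (f g : V → V) : mapMatrix f * mapMatrix g = mapMatrix (g ∘ f) := by
  ext v w
  simp only [mapMatrix, Matrix.mul_apply, Matrix.of_apply, ite_mul, one_mul, zero_mul,
    Finset.sum_ite_eq, Finset.mem_univ, if_true, comp_apply]

theorem mapMatrix_pow (f : V → V) (k : ℕ) : mapMatrix f ^ k = mapMatrix f^[k] := by
  induction k with
  | zero => ext v w; rw [pow_zero, Matrix.one_apply]; rfl
  | succ k ih => rw [pow_succ, ih, mapMatrix_mul, iterate_succ']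

theorem trace_mapMatrix (f : V → V) :
    (mapMatrix f).trace = (Finset.univ.filter fun v => f v = v).card := by
  simp [mapMatrix, Matrix.trace]

end MapMatrix

variable {n m : ℕ} [NeZero n] [NeZero m]

/-- The transition matrix of the random walk on the torus with steps right and up. -/
noncomputable def meanMatrix (n m : ℕ) : Matrix (Torus n m) (Torus n m) ℝ :=
  (1 / 2 : ℝ) • (mapMatrix (fun v => (v.1 + 1, v.2)) + mapMatrix fun v => (v.1, v.2 + 1))

/-- Row `v` depends only on the coin at `v`, and the determinant is multilinear in the rows, so
averaging the coins commutes with it. -/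
theorem det_one_sub_meanMatrix (s : ℝ) :
    (1 - s • meanMatrix n m).det = ∑ ω : Config n m,
      (1 / 2) ^ Fintype.card (Torus n m) * (1 - s • mapMatrix (walk ω)).det := by
  set r : Torus n m → Bool → Torus n m → ℝ := fun v b w =>
    (1 : Matrix (Torus n m) (Torus n m) ℝ) v w -
      s * if (if b = true then (v.1 + 1, v.2) else (v.1, v.2 + 1)) = w then 1 else 0 with hr
  have h1 : (1 - s • meanMatrix n m) = fun v => ∑ b : Bool, (1 / 2 : ℝ) • r v b := by
    ext v w
    simp only [hr, meanMatrix, mapMatrix, Fintype.sum_bool, Matrix.sub_apply, Matrix.smul_apply,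
      Matrix.add_apply, Matrix.of_apply, Pi.add_apply, Pi.smul_apply, smul_eq_mul, if_true,
      Bool.false_eq_true, if_false]
    ring
  have h2 := (Matrix.detRowAlternating (R := ℝ) (n := Torus n m)).toMultilinearMap.map_sum
    fun v b => (1 / 2 : ℝ) • r v b
  rw [h1]
  refine h2.trans (Finset.sum_congr rfl fun ω _ => ?_)
  rw [MultilinearMap.map_smul_univ (Matrix.detRowAlternating (R := ℝ)).toMultilinearMap
    (fun _ => (1 / 2 : ℝ)) fun v => r v (ω v)]
  rw [Finset.prod_const, Finset.card_univ, smul_eq_mul]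
  rfl

theorem meanMatrix_pow (k : ℕ) : ∃ g : ℕ → Torus n m → Torus n m,
    (∀ j, g j = (fun v : Torus n m => (v.1, v.2 + 1))^[k - j] ∘ (fun v => (v.1 + 1, v.2))^[j]) ∧
    (meanMatrix n m ^ k).trace = (1 / 2) ^ k *
      ∑ j ∈ Finset.range (k + 1), (k.choose j : ℝ) * (Finset.univ.filter fun v => g j v = v).card := by
  refine ⟨_, fun j => rfl, ?_⟩
  have hc : Commute (mapMatrix fun v : Torus n m => (v.1 + 1, v.2))
      (mapMatrix fun v : Torus n m => (v.1, v.2 + 1)) := by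
    rw [Commute, SemiconjBy, mapMatrix_mul, mapMatrix_mul]; rfl
  rw [meanMatrix, smul_pow, hc.add_pow, Matrix.trace_smul, Matrix.trace_sum, smul_eq_mul]
  congr 1
  refine Finset.sum_congr rfl fun j _ => ?_
  rw [mapMatrix_pow, mapMatrix_pow, mapMatrix_mul, ← nsmul_eq_mul', Matrix.trace_smul,
    trace_mapMatrix, nsmul_eq_mul]

theorem trace_meanMatrix_pow_nonneg (k : ℕ) : 0 ≤ (meanMatrix n m ^ k).trace := by
  obtain ⟨g, -, h⟩ := meanMatrix_pow (n := n) (m := m) k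
  rw [h]
  positivity

/-- Right and up translations commute, so the binomial theorem applies; only the term with `n` right
and `m` up steps is kept, for which every vertex is fixed. -/
theorem le_trace_meanMatrix_pow :
    (n * m : ℝ) * ((n + m).choose n * (1 / 2) ^ (n + m)) ≤ (meanMatrix n m ^ (n + m)).trace := by
  obtain ⟨g, hg, h⟩ := meanMatrix_pow (n := n) (m := m) (n + m)
  rw [h]
  have h1 : ∀ (k : ℕ) (v : Torus n m), (fun v : Torus n m => (v.1 + 1, v.2))^[k] v
      = (v.1 + k, v.2) := by
    intro k v
    induction k with
    | zero => simp
    | succ k ih => rw [iterate_succ_apply', ih]; simp [add_assoc]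
  have h2 : ∀ (k : ℕ) (v : Torus n m), (fun v : Torus n m => (v.1, v.2 + 1))^[k] v
      = (v.1, v.2 + k) := by
    intro k v
    induction k with
    | zero => simp
    | succ k ih => rw [iterate_succ_apply', ih]; simp [add_assoc]
  have h3 : (Finset.univ.filter fun v => g n v = v).card = n * m := by
    rw [Finset.filter_true_of_mem]
    · rw [Finset.card_univ, Fintype.card_prod, ZMod.card, ZMod.card]
    · intro v _
      rw [hg, comp_apply, h1, h2]
      simp
  have h4 := Finset.single_le_sum
    (f := fun j => ((n + m).choose j : ℝ) * (Finset.univ.filter fun v => g j v = v).card)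
    (s := Finset.range (n + m + 1)) (fun j _ => by positivity) (Finset.mem_range.2
      (by omega : n < n + m + 1))
  rw [h3] at h4
  refine le_trans (le_of_eq ?_) (mul_le_mul_of_nonneg_left h4 (by positivity))
  push_cast
  ring

theorem det_one_sub_meanMatrix_le (s : ℝ) (hs : 0 ≤ s) (hs1 : s < 1) :
    (1 - s • meanMatrix n m).det ≤
      Real.exp (-(s ^ (n + m) * ((n * m : ℝ) * ((n + m).choose n * (1 / 2) ^ (n + m))) / (n + m))) := by
  obtain ⟨S, h1, h2⟩ := exists_hasSum_trace_pow_div (s • meanMatrix n m) s hs hs1 (by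
    intro v
    have : ∀ w, |(s • meanMatrix n m) v w| = (s / 2) * (if (v.1 + 1, v.2) = w then 1 else 0) +
        (s / 2) * (if (v.1, v.2 + 1) = w then 1 else 0) := by
      intro w
      have h : (s • meanMatrix n m) v w = (s / 2) * (if (v.1 + 1, v.2) = w then 1 else 0) +
        (s / 2) * (if (v.1, v.2 + 1) = w then 1 else 0) := by
        simp only [meanMatrix, mapMatrix, Matrix.smul_apply, Matrix.add_apply, Matrix.of_apply,
          smul_eq_mul]
        ring
      rw [h, abs_of_nonneg]
      split_ifs <;> positivity
    simp only [this, Finset.sum_add_distrib, ← Finset.mul_sum, Finset.sum_ite_eq, Finset.mem_univ,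
      if_true]
    linarith)
  rw [h2, Real.exp_le_exp, neg_le_neg_iff]
  have h3 := le_hasSum h1 (n + m) fun k _ => by
    rw [smul_pow, Matrix.trace_smul, smul_eq_mul]
    have := trace_meanMatrix_pow_nonneg (n := n) (m := m) k
    positivity
  refine le_trans ?_ h3
  rw [smul_pow, Matrix.trace_smul, smul_eq_mul]
  push_cast
  gcongr
  exact le_trace_meanMatrix_pow

theorem card_filter_iterate_eq_le {ω : Config n m} (h : ω ∉ offDiagonal n m) {k : ℕ} (hk : 0 < k) :
    (Finset.univ.filter fun v => (walk ω)^[k] v = v).card ≤ (n + m) * numCycles 1 1 ω := by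
  classical
  set s := Finset.univ.filter fun v => (walk ω)^[k] v = v with hs
  have hper : ∀ v ∈ s, v ∈ periodicPts (walk ω) := fun v hv =>
    ⟨k, hk, (Finset.mem_filter.1 hv).2⟩
  set o : Torus n m → Set (Torus n m) := fun v => {w | w ∈ periodicOrbit (walk ω) v} with ho
  have h1 : s.card ≤ (n + m) * (s.image o).card := by
    refine Finset.card_le_mul_card_image s _ fun a ha => ?_
    obtain ⟨v, hv, rfl⟩ := Finset.mem_image.1 ha
    have h2 := ncard_periodicOrbit_inter (hper v hv) fun _ => True
    simp only [and_true, Finset.filter_true, Finset.card_range] at h2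
    rw [(isClosedOrbit_of_notMem_offDiagonal h (hper v hv)).1] at h2
    rw [← h2, ← Set.ncard_coe_finset]
    refine Set.ncard_le_ncard (fun x hx => ?_) (Set.toFinite _)
    simp only [Finset.coe_filter, Set.mem_ofPred_eq] at hx
    have h3 : x ∈ o x := self_mem_periodicOrbit (hper x hx.1)
    rw [hx.2] at h3
    exact h3
  refine h1.trans (Nat.mul_le_mul_left _ ?_)
  rw [← Set.ncard_coe_finset]
  refine Set.ncard_le_ncard (fun C hC => ?_) (Set.toFinite _)
  obtain ⟨v, hv, rfl⟩ := Finset.mem_image.1 (Finset.mem_coe.1 hC)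
  exact ⟨⟨v, hper v hv, rfl⟩, (isClosedOrbit_of_notMem_offDiagonal h (hper v hv)).2⟩

theorem dvd_of_iterate_eq {ω : Config n m} (h : ω ∉ offDiagonal n m) {k : ℕ} (hk : 0 < k)
    {v : Torus n m} (hv : (walk ω)^[k] v = v) : n + m ∣ k := by
  have hp : IsPeriodicPt (walk ω) k v := hv
  rw [← (isClosedOrbit_of_notMem_offDiagonal h ⟨k, hk, hp⟩).1]
  exact hp.minimalPeriod_dvd

theorem exists_hasSum_mapMatrix (ω : Config n m) (s : ℝ) (hs : 0 ≤ s) (hs1 : s < 1) :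
    ∃ S : ℝ, HasSum (fun k : ℕ => s ^ k *
      ((Finset.univ.filter fun v => (walk ω)^[k] v = v).card : ℝ) / k) S ∧
      (1 - s • mapMatrix (walk ω)).det = Real.exp (-S) := by
  obtain ⟨S, h1, h2⟩ := exists_hasSum_trace_pow_div (s • mapMatrix (walk ω)) s hs hs1 (by
    intro v
    have : ∀ w, |(s • mapMatrix (walk ω)) v w| = s * (if walk ω v = w then 1 else 0) := by
      intro w
      have h : (s • mapMatrix (walk ω)) v w = s * (if walk ω v = w then 1 else 0) := rfl
      rw [h, abs_of_nonneg]
      split_ifs <;> simp [hs]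
    simp only [this, ← Finset.mul_sum, Finset.sum_ite_eq, Finset.mem_univ, if_true, mul_one, le_refl])
  refine ⟨S, ?_, h2⟩
  simpa only [smul_pow, Matrix.trace_smul, smul_eq_mul, mapMatrix_pow, trace_mapMatrix] using h1

/-- Only times `(n + m) * j` have fixed points, at most `(n + m) * N` of them with `N` the number of
cycles. The trace series is thus at most `∑ N * 2 ^ (-j) / j`; dropping `1 / j` and including `j =
0` gives the crude bound `2 * N`. -/
theorem exp_le_det_one_sub_mapMatrix {ω : Config n m} (h : ω ∉ offDiagonal n m) (s : ℝ)
    (hs : 0 ≤ s) (hs1 : s < 1) (hsW : s ^ (n + m) = 1 / 2) :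
    Real.exp (-(2 * (numCycles 1 1 ω : ℝ))) ≤ (1 - s • mapMatrix (walk ω)).det := by
  have hn : 0 < n := Nat.pos_of_neZero n
  obtain ⟨S, h1, h2⟩ := exists_hasSum_mapMatrix ω s hs hs1
  rw [h2, Real.exp_le_exp, neg_le_neg_iff]
  have hinj : Injective fun j : ℕ => (n + m) * j := fun a b hab =>
    Nat.eq_of_mul_eq_mul_left (by omega) hab
  rw [← hinj.hasSum_iff] at h1
  · have h3 := (hasSum_geometric_two).mul_left (numCycles 1 1 ω : ℝ)
    rw [mul_comm 2]
    refine hasSum_le (fun j => ?_) h1 h3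
    rcases Nat.eq_zero_or_pos j with rfl | hj
    · simp
    · rw [comp_apply, pow_mul, hsW]
      have h4 := card_filter_iterate_eq_le h (k := (n + m) * j) (Nat.mul_pos (by omega) hj)
      have h5 : ((Finset.univ.filter fun v => (walk ω)^[(n + m) * j] v = v).card : ℝ)
        ≤ (n + m : ℕ) * (numCycles 1 1 ω : ℝ) := by exact_mod_cast h4
      have hj' : (1 : ℝ) ≤ j := by exact_mod_cast hj
      have hW : (0 : ℝ) < (n + m : ℕ) := by exact_mod_cast (by omega : 0 < n + m)
      have hWj : (0 : ℝ) < ((n + m) * j : ℕ) := by exact_mod_cast Nat.mul_pos (by omega) hj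
      rw [div_le_iff₀ hWj]
      calc (1 / 2 : ℝ) ^ j * _ ≤ (1 / 2) ^ j * ((n + m : ℕ) * (numCycles 1 1 ω : ℝ)) := by gcongr
        _ ≤ (1 / 2) ^ j * ((n + m : ℕ) * (numCycles 1 1 ω : ℝ)) * j :=
          le_mul_of_one_le_right (by positivity) hj'
        _ = _ := by push_cast; ring
  · intro k hk
    rcases Nat.eq_zero_or_pos k with rfl | hk0
    · simp
    · have : (Finset.univ.filter fun v => (walk ω)^[k] v = v) = ∅ := by
        refine Finset.filter_eq_empty_iff.2 fun v _ hv => hk ?_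
        obtain ⟨j, hj⟩ := dvd_of_iterate_eq h hk0 hv
        exact ⟨j, hj.symm⟩
      rw [this]; simp

theorem law_real_numCycles_le (x : ℝ) :
    (law n m).real {ω | ω ∉ offDiagonal n m ∧ (numCycles 1 1 ω : ℝ) ≤ x}
      ≤ Real.exp (2 * x -
        (n * m : ℝ) * ((n + m).choose n * (1 / 2) ^ (n + m)) / (2 * (n + m))) := by
  classical
  have hn : 0 < n := Nat.pos_of_neZero n
  set s : ℝ := (1 / 2) ^ ((n + m : ℕ) : ℝ)⁻¹ with hsdef
  have hs : 0 ≤ s := by positivity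
  have hs1 : s < 1 := Real.rpow_lt_one (by norm_num) (by norm_num)
    (inv_pos.2 (by exact_mod_cast (by omega : 0 < n + m)))
  have hsW : s ^ (n + m) = 1 / 2 := Real.rpow_inv_natCast_pow (by norm_num) (by omega)
  have h1 := det_one_sub_meanMatrix_le (n := n) (m := m) s hs hs1
  rw [det_one_sub_meanMatrix, hsW] at h1
  have h2 : Real.exp (-(2 * x)) *
      (law n m).real {ω | ω ∉ offDiagonal n m ∧ (numCycles 1 1 ω : ℝ) ≤ x} ≤
      ∑ ω : Config n m, (1 / 2) ^ Fintype.card (Torus n m) * (1 - s • mapMatrix (walk ω)).det := by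
    rw [law_real_eq_sum, Finset.mul_sum]
    refine Finset.sum_le_sum fun ω _ => ?_
    split_ifs with h
    · rw [mul_comm]
      refine mul_le_mul_of_nonneg_left ?_ (by positivity)
      refine le_trans ?_ (exp_le_det_one_sub_mapMatrix h.1 s hs hs1 hsW)
      rw [Real.exp_le_exp]
      linarith [h.2]
    -- The discarded configurations contribute positively: their determinants are exponentials.
    · obtain ⟨S, -, h3⟩ := exists_hasSum_mapMatrix ω s hs hs1
      rw [h3, mul_zero]
      positivity
  have h3 := h2.trans h1
  rw [mul_comm, ← le_div_iff₀ (Real.exp_pos _), ← Real.exp_sub] at h3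
  refine h3.trans_eq ?_
  congr 1
  field_simp
  ring

end LowerTail

/-! ### Explicit rates when `m - n` is of order `√n` -/

section Rates

theorem eventually_nat_pow_mul_exp_le (A : ℝ) (k : ℕ) {a b : ℝ} (hab : b < a) :
    ∀ᶠ n : ℕ in atTop, A * (n : ℝ) ^ k * Real.exp (-(a * √n)) ≤ Real.exp (-(b * √n)) := by
  have h1 := (Real.tendsto_pow_mul_exp_neg_atTop_nhds_zero (2 * k)).comp
    (Tendsto.const_mul_atTop (sub_pos.2 hab)
      (Real.tendsto_sqrt_atTop.comp tendsto_natCast_atTop_atTop))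
  have h2 := (h1.const_mul (A / (a - b) ^ (2 * k))).eventually_le_const
    (show A / (a - b) ^ (2 * k) * 0 < 1 by simp)
  filter_upwards [h2] with n hn
  have hab' : a - b ≠ 0 := (sub_pos.2 hab).ne'
  have hsq : √(n : ℝ) ^ (2 * k) = (n : ℝ) ^ k := by rw [pow_mul, Real.sq_sqrt (by positivity)]
  have h3 : A / (a - b) ^ (2 * k) * (((a - b) * √(n : ℝ)) ^ (2 * k) *
      Real.exp (-((a - b) * √(n : ℝ)))) = A * (n : ℝ) ^ k * Real.exp (-((a - b) * √(n : ℝ))) := by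
    rw [mul_pow, hsq]; field_simp
  have h4 : A * (n : ℝ) ^ k * Real.exp (-((a - b) * √(n : ℝ))) ≤ 1 := h3 ▸ hn
  calc A * (n : ℝ) ^ k * Real.exp (-(a * √n))
      = (A * (n : ℝ) ^ k * Real.exp (-((a - b) * √(n : ℝ)))) * Real.exp (-(b * √n)) := by
        rw [mul_assoc _ (Real.exp _), ← Real.exp_add]; congr 2; ring
    _ ≤ 1 * Real.exp (-(b * √n)) := by gcongr
    _ = _ := one_mul _

variable {ρ : ℝ} {n m : ℕ}

theorem exp_neg_sq_div_le (hn : 1 ≤ n) (hnm : n ≤ m) (hm2 : m ≤ 2 * n)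
    (hm : (m : ℝ) ≤ n + 2 * ρ * √n) {J : ℕ} {ε : ℝ} (hJ : (J : ℝ) ≤ ε * √n) (hε : ε ≤ 1)
    (hερ : 12 * ρ * ε ≤ 1) (p q : ℕ) (hpq : p ≠ q) (hs : p + q ≤ 3 * J) :
    Real.exp (-(((p * n : ℝ) - q * m) ^ 2 / (2 * (p * n + q * m)))) ≤ Real.exp (-(√n / 48)) := by
  have hn' : (1 : ℝ) ≤ n := by exact_mod_cast hn
  have hnm' : (n : ℝ) ≤ m := by exact_mod_cast hnm
  have hm2' : (m : ℝ) ≤ 2 * n := by exact_mod_cast hm2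
  have hs' : (p : ℝ) + q ≤ 3 * J := by exact_mod_cast hs
  have hsq : √(n : ℝ) * √n = n := Real.mul_self_sqrt (by positivity)
  have hsp : 0 < √(n : ℝ) := Real.sqrt_pos.2 (by linarith)
  have hp0 : (0 : ℝ) ≤ p := by positivity
  have hq0 : (0 : ℝ) ≤ q := by positivity
  rw [Real.exp_le_exp, neg_le_neg_iff]
  have hpos : (0 : ℝ) < p * n + q * m := by
    rcases Nat.eq_zero_or_pos p with rfl | h
    · have : (1 : ℝ) ≤ q := by exact_mod_cast (by omega : 1 ≤ q)
      nlinarith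
    · have : (1 : ℝ) ≤ p := by exact_mod_cast h
      nlinarith
  -- Write `p * n - q * m = (p - q) * n - q * (m - n)`: the first term is at least `n` in absolute
  -- value, and `12 * ρ * ε ≤ 1` keeps the correction below half of that.
  have hq3 : (q : ℝ) * (m - n) ≤ n / 2 := by
    have h1 : (q : ℝ) ≤ 3 * (ε * √n) := by linarith
    calc (q : ℝ) * (m - n) ≤ (3 * (ε * √n)) * (2 * ρ * √n) :=
          mul_le_mul h1 (by linarith) (by linarith) (by linarith)
      _ = (12 * ρ * ε) * (√n * √n) / 2 := by ring
      _ ≤ 1 * (√n * √n) / 2 := by gcongr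
      _ = n / 2 := by rw [hsq]; ring
  have habs : (n : ℝ) / 2 ≤ |(p * n : ℝ) - q * m| := by
    have h0 : (0 : ℝ) ≤ q * (m - n) := mul_nonneg hq0 (by linarith)
    rcases lt_or_gt_of_ne hpq with h | h
    · have h1 : (p : ℝ) + 1 ≤ q := by exact_mod_cast h
      rw [abs_sub_comm]
      refine le_trans ?_ (le_abs_self _)
      nlinarith
    · have h1 : (q : ℝ) + 1 ≤ p := by exact_mod_cast h
      refine le_trans ?_ (le_abs_self _)
      nlinarith
  have hnum : (n / 2 : ℝ) ^ 2 ≤ ((p * n : ℝ) - q * m) ^ 2 := by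
    rw [← sq_abs ((p * n : ℝ) - q * m)]
    gcongr
  have hden : (p * n + q * m : ℝ) ≤ 6 * √n * n := by
    have hJ' : (J : ℝ) ≤ √n := hJ.trans (mul_le_of_le_one_left hsp.le hε)
    calc (p * n + q * m : ℝ) ≤ (p + q) * m := by nlinarith
      _ ≤ (3 * √n) * (2 * n) := by
        refine mul_le_mul (by linarith) hm2' (by positivity) (by positivity)
      _ = _ := by ring
  rw [le_div_iff₀ (by positivity)]
  refine le_trans ?_ hnum
  calc √(n : ℝ) / 48 * (2 * (p * n + q * m)) ≤ √(n : ℝ) / 48 * (2 * (6 * √n * n)) := by gcongr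
    _ = (√n * √n) * n / 4 := by ring
    _ = _ := by rw [hsq]; ring

/-- The exponential rate in the bound on the probability of an off-diagonal closed orbit. -/
noncomputable def offRate (ρ : ℝ) : ℝ :=
  min (Real.exp (-(8 * (ρ + 1) ^ 2)) / 2 * min 1 (1 / (12 * ρ))) (1 / 48)

theorem offRate_pos (hρ : 0 < ρ) : 0 < offRate ρ := by
  unfold offRate
  positivity

theorem law_real_offDiagonal_le_exp (hρ : 0 < ρ) (hn : 4 ≤ n) (hnm : n ≤ m) (hm2 : m ≤ 2 * n)
    (hm : (m : ℝ) ≤ n + 2 * ρ * √n) :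
    (law n m).real (offDiagonal n m) ≤ 44 * (n : ℝ) ^ 3 * Real.exp (-(offRate ρ * √n)) := by
  have : NeZero n := ⟨by omega⟩
  have : NeZero m := ⟨by omega⟩
  have hn' : (4 : ℝ) ≤ n := by exact_mod_cast hn
  have hm2' : (m : ℝ) ≤ 2 * n := by exact_mod_cast hm2
  have hsq : √(n : ℝ) * √n = n := Real.mul_self_sqrt (by positivity)
  have hs1 : 1 ≤ √(n : ℝ) := Real.one_le_sqrt.2 (by linarith)
  set δ : ℝ := Real.exp (-(8 * (ρ + 1) ^ 2)) / 2 with hδ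
  set ε : ℝ := min 1 (1 / (12 * ρ)) with hε
  have hδ0 : 0 < δ := by positivity
  have hδ1 : δ ≤ 1 / 2 := by
    have : Real.exp (-(8 * (ρ + 1) ^ 2)) ≤ 1 := Real.exp_le_one_iff.2 (by
      have : 0 ≤ 8 * (ρ + 1) ^ 2 := by positivity
      linarith)
    rw [hδ]; linarith
  have hε0 : 0 < ε := by positivity
  have hε1 : ε ≤ 1 := min_le_left _ _
  have hερ : 12 * ρ * ε ≤ 1 := by
    calc 12 * ρ * ε ≤ 12 * ρ * (1 / (12 * ρ)) := by gcongr; exact min_le_right _ _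
      _ = 1 := by field_simp
  have ha1 : offRate ρ ≤ δ * ε := min_le_left _ _
  have ha2 : offRate ρ ≤ 1 / 48 := min_le_right _ _
  set J := ⌊ε * √(n : ℝ)⌋₊ with hJdef
  have hJ : (J : ℝ) ≤ ε * √n := Nat.floor_le (by positivity)
  have hJ2 : ε * √n < J + 1 := Nat.lt_floor_add_one _
  have hJ' : (J : ℝ) ≤ √n := hJ.trans (mul_le_of_le_one_left (by positivity) hε1)
  refine (law_real_offDiagonal_le hnm hm2 J δ (Real.exp (-(√n / 48)))
    (le_sum_choose ρ hρ n m hn hnm hm) (Real.exp_pos _).le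
    (exp_neg_sq_div_le (by omega) hnm hm2 hm hJ hε1 hερ)).trans ?_
  have h1 : (1 - δ) ^ J ≤ 3 * Real.exp (-(offRate ρ * √n)) := by
    calc (1 - δ) ^ J ≤ Real.exp (-δ) ^ J :=
          pow_le_pow_left₀ (by linarith) (Real.one_sub_le_exp_neg δ) J
      _ = Real.exp (J * -δ) := (Real.exp_nat_mul _ _).symm
      -- Rounding `ε * √n` down to `J` costs at most `δ ≤ 1` in the exponent.
      _ ≤ Real.exp (1 + -(offRate ρ * √n)) := by
        rw [Real.exp_le_exp]
        have : offRate ρ * √n ≤ δ * ε * √n := by gcongr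
        nlinarith
      _ ≤ 3 * Real.exp (-(offRate ρ * √n)) := by
        rw [Real.exp_add]
        gcongr
        exact Real.exp_one_lt_three.le
  have h2 : Real.exp (-(√(n : ℝ) / 48)) ≤ Real.exp (-(offRate ρ * √n)) := by
    rw [Real.exp_le_exp, neg_le_neg_iff]
    have : offRate ρ * √n ≤ 1 / 48 * √n := by gcongr
    linarith
  have h3 : (3 * (J : ℝ) + 1) ^ 2 ≤ 16 * n := by
    calc (3 * (J : ℝ) + 1) ^ 2 ≤ (4 * √n) ^ 2 := by gcongr; linarith
      _ = 16 * (√n * √n) := by ring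
      _ = _ := by rw [hsq]
  have h4 : 2 * (1 - δ) ^ J + (3 * (J : ℝ) + 1) ^ 2 * Real.exp (-(√(n : ℝ) / 48)) ≤
      (6 + 16 * n) * Real.exp (-(offRate ρ * √n)) := by
    have := mul_le_mul h3 h2 (Real.exp_pos _).le (by positivity)
    linarith
  calc (n * m : ℝ) * (2 * (1 - δ) ^ J + (3 * (J : ℝ) + 1) ^ 2 * Real.exp (-(√(n : ℝ) / 48)))
      ≤ (n * (2 * n)) * ((6 + 16 * n) * Real.exp (-(offRate ρ * √n))) := by
        refine mul_le_mul (by gcongr) h4 ?_ (by positivity)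
        have : 0 ≤ (1 - δ) ^ J := pow_nonneg (by linarith) J
        positivity
    _ = (n ^ 2 * (12 + 32 * n)) * Real.exp (-(offRate ρ * √n)) := by ring
    _ ≤ (44 * n ^ 3) * Real.exp (-(offRate ρ * √n)) := by
        refine mul_le_mul_of_nonneg_right ?_ (Real.exp_pos _).le
        have : (12 + 32 * n : ℝ) ≤ 44 * n := by linarith
        calc (n : ℝ) ^ 2 * (12 + 32 * n) ≤ n ^ 2 * (44 * n) := by gcongr
          _ = _ := by ring

/-- A lower bound for the mean number of closed orbits of class `(1, 1)`, in units of `√n`. -/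
theorem le_mean_div (hn : 4 ≤ n) (hnm : n ≤ m) (hm : (m : ℝ) ≤ n + 2 * ρ * √n) :
    Real.exp (-(4 * ρ ^ 2)) / 8 * √n ≤
      (n * m : ℝ) * ((n + m).choose n * (1 / 2) ^ (n + m)) / (2 * (n + m)) := by
  have hn' : (4 : ℝ) ≤ n := by exact_mod_cast hn
  have hnm' : (n : ℝ) ≤ m := by exact_mod_cast hnm
  have hsq : √(n : ℝ) * √n = n := Real.mul_self_sqrt (by positivity)
  have hsp : 0 < √(n : ℝ) := Real.sqrt_pos.2 (by linarith)
  have h1 := le_choose_div_two_pow n (m - n) (by omega)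
  rw [show 2 * n + (m - n) = n + m by omega, Nat.cast_sub hnm] at h1
  have h2 : ((m : ℝ) - n) ^ 2 / n ≤ 4 * ρ ^ 2 := by
    rw [div_le_iff₀ (by linarith)]
    calc ((m : ℝ) - n) ^ 2 ≤ (2 * ρ * √n) ^ 2 :=
          pow_le_pow_left₀ (by linarith) (by linarith) 2
      _ = 4 * ρ ^ 2 * (√n * √n) := by ring
      _ = _ := by rw [hsq]
  have h3 : Real.exp (-(4 * ρ ^ 2)) / (2 * √n) ≤ ((n + m).choose n * (1 / 2) ^ (n + m) : ℝ) := by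
    rw [one_div, inv_pow, ← div_eq_mul_inv]
    refine le_trans ?_ h1
    gcongr
  have h4 : (n : ℝ) / 4 ≤ n * m / (2 * (n + m)) := by
    rw [div_le_div_iff₀ (by norm_num) (by linarith)]
    nlinarith
  calc Real.exp (-(4 * ρ ^ 2)) / 8 * √n
      = (√n * √n) / 4 * (Real.exp (-(4 * ρ ^ 2)) / (2 * √n)) := by field_simp; ring
    _ = n / 4 * (Real.exp (-(4 * ρ ^ 2)) / (2 * √n)) := by rw [hsq]
    _ ≤ (n * m / (2 * (n + m))) * ((n + m).choose n * (1 / 2) ^ (n + m)) := by gcongr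
    _ = _ := by ring

theorem law_real_six_mul_sqrt_lt_numCycles_le (hn : 4 ≤ n) (hnm : n ≤ m) (hm2 : m ≤ 2 * n) :
    (law n m).real {ω | (numCycles 1 1 ω : ℝ) > 6 * √n} ≤ Real.exp (-((6 : ℝ)⁻¹ * √n)) := by
  have : NeZero n := ⟨by omega⟩
  have : NeZero m := ⟨by omega⟩
  have hn' : (4 : ℝ) ≤ n := by exact_mod_cast hn
  have hm2' : (m : ℝ) ≤ 2 * n := by exact_mod_cast hm2
  have hsq : √(n : ℝ) * √n = n := Real.mul_self_sqrt (by positivity)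
  have hsp : 0 < √(n : ℝ) := Real.sqrt_pos.2 (by linarith)
  refine (law_real_lt_numCycles_le (6 * √n)).trans ?_
  rw [Real.exp_le_exp]
  have h1 := choose_div_two_pow_le n m (by omega) hnm
  have h2 : (m : ℝ) * ((n + m).choose n * (1 / 2) ^ (n + m)) ≤ 2 * √n := by
    rw [one_div, inv_pow, ← div_eq_mul_inv]
    calc (m : ℝ) * (((n + m).choose n : ℝ) / 2 ^ (n + m)) ≤ (2 * n) * (1 / √n) := by gcongr
      _ = 2 * (√n * √n) * (1 / √n) := by rw [hsq]
      _ = _ := by field_simp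
  -- The exponent is at most `(2 - 6 * log 2) * √n`, well below `-√n / 6`; so `6` can be both the
  -- threshold and the inverse rate.
  have := Real.log_two_gt_d9
  nlinarith

end Rates

end QuenchedWalk

theorem mainTheorem1 (ρ : ℝ) (hρ : 0 < ρ) :
    ∃ c : ℝ, 0 < c ∧ ∃ K : ℝ, 0 < K ∧
      ∀ m : ℕ → ℕ,
        IsEquivalent atTop (fun n : ℕ => (m n : ℝ) - (n : ℝ)) (fun n : ℕ => ρ * √(n : ℝ)) →
        ∀ᶠ n : ℕ in atTop,
          (QuenchedWalk.law n (m n)).real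
              {ω | ∀ C, QuenchedWalk.IsClosedOrbit ω C → QuenchedWalk.HasHomologyClass ω C 1 1}
            > 1 - Real.exp (-(c * √(n : ℝ))) ∧
          (QuenchedWalk.law n (m n)).real
              {ω | (QuenchedWalk.numCycles 1 1 ω : ℝ) > c * √(n : ℝ)}
            ≥ 1 - Real.exp (-(c * √(n : ℝ))) ∧
          (QuenchedWalk.law n (m n)).real
              {ω | (QuenchedWalk.numCycles 1 1 ω : ℝ) > K * √(n : ℝ)}
            ≤ Real.exp (-(K⁻¹ * √(n : ℝ))) := by
  set a := QuenchedWalk.offRate ρ with ha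
  have ha0 : 0 < a := QuenchedWalk.offRate_pos hρ
  set b := Real.exp (-(4 * ρ ^ 2)) / 8 with hb
  have hb0 : 0 < b := by positivity
  -- The condition `c < a` absorbs the factor `n ^ 3`. As `2 * c ≤ b / 2`, the lower-tail exponent
  -- `2 * c - b` is at most `-b / 2`, and `c < b / 2` leaves room for a factor `2`.
  set c := min a b / 4 with hc
  have hc0 : 0 < c := by positivity
  have hca : c < a := by
    have := min_le_left a b
    linarith
  have hcb : c ≤ b / 4 := by
    have := min_le_right a b
    linarith
  refine ⟨c, hc0, 6, by norm_num, fun m hm => ?_⟩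
  -- Relative error `1` suffices: it gives `n ≤ m ≤ n + 2 * ρ * √n`, all that the bounds use besides
  -- `m ≤ 2 * n`.
  have hequiv := hm.isLittleO.def one_pos
  have hbig : ∀ᶠ n : ℕ in atTop, 2 * ρ ≤ √(n : ℝ) :=
    (Real.tendsto_sqrt_atTop.comp tendsto_natCast_atTop_atTop).eventually_ge_atTop _
  have h1 := QuenchedWalk.eventually_nat_pow_mul_exp_le (3 * 44) 3 hca
  have h2 := QuenchedWalk.eventually_nat_pow_mul_exp_le 2 0 (show c < b / 2 by linarith)
  filter_upwards [hequiv, hbig, h1, h2, eventually_ge_atTop 4] with n he hbig h1 h2 hn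
  have hsq : √(n : ℝ) * √n = n := Real.mul_self_sqrt (by positivity)
  have hs0 : 0 ≤ √(n : ℝ) := Real.sqrt_nonneg _
  simp only [Pi.sub_apply, one_mul, Real.norm_eq_abs] at he
  rw [abs_of_nonneg (show 0 ≤ ρ * √(n : ℝ) by positivity), abs_le] at he
  have hnm' : (n : ℝ) ≤ m n := by linarith [he.1]
  have hnm : n ≤ m n := by exact_mod_cast hnm'
  have hmρ : (m n : ℝ) ≤ n + 2 * ρ * √n := by linarith [he.2]
  have hm2 : m n ≤ 2 * n := by
    have : (m n : ℝ) ≤ 2 * n := by nlinarith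
    exact_mod_cast this
  have : NeZero n := ⟨by omega⟩
  have : NeZero (m n) := ⟨by omega⟩
  set E := Real.exp (-(c * √(n : ℝ))) with hE
  have hE0 : 0 < E := Real.exp_pos _
  -- The third gives the strict inequality of the first claim, and in the second leaves room for the
  -- `E / 2` of the lower tail.
  have hoff : (QuenchedWalk.law n (m n)).real (QuenchedWalk.offDiagonal n (m n)) ≤ E / 3 := by
    refine (QuenchedWalk.law_real_offDiagonal_le_exp hρ hn hnm hm2 hmρ).trans ?_
    rw [← ha]
    linarith
  have hcov : ∀ A B : Set (QuenchedWalk.Config n (m n)), Set.univ ⊆ A ∪ B →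
      1 - (QuenchedWalk.law n (m n)).real B ≤ (QuenchedWalk.law n (m n)).real A := by
    intro A B hAB
    have h3 := (measureReal_mono (μ := QuenchedWalk.law n (m n)) hAB).trans
      (measureReal_union_le A B)
    rw [probReal_univ] at h3
    linarith
  refine ⟨?_, ?_, QuenchedWalk.law_real_six_mul_sqrt_lt_numCycles_le hn hnm hm2⟩
  · refine lt_of_lt_of_le ?_ (hcov _ (QuenchedWalk.offDiagonal n (m n)) fun ω _ => ?_)
    · linarith
    · by_cases h : ω ∈ QuenchedWalk.offDiagonal n (m n)
      · exact Or.inr h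
      · refine Or.inl ?_
        rintro C ⟨v, hv, rfl⟩
        exact (QuenchedWalk.isClosedOrbit_of_notMem_offDiagonal h hv).2
  · refine le_trans ?_ (hcov _ (QuenchedWalk.offDiagonal n (m n) ∪
      {ω | ω ∉ QuenchedWalk.offDiagonal n (m n) ∧
        (QuenchedWalk.numCycles 1 1 ω : ℝ) ≤ c * √(n : ℝ)}) fun ω _ => ?_)
    · have h3 := QuenchedWalk.law_real_numCycles_le (n := n) (m := m n) (c * √(n : ℝ))
      have h4 := QuenchedWalk.le_mean_div (ρ := ρ) hn hnm hmρ
      have h5 : (QuenchedWalk.law n (m n)).real {ω | ω ∉ QuenchedWalk.offDiagonal n (m n) ∧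
          (QuenchedWalk.numCycles 1 1 ω : ℝ) ≤ c * √(n : ℝ)} ≤ Real.exp (-(b / 2 * √n)) := by
        refine h3.trans (Real.exp_le_exp.2 ?_)
        have : c * √(n : ℝ) ≤ b / 4 * √n := by gcongr
        rw [← hb] at h4
        linarith
      have h6 := measureReal_union_le (μ := QuenchedWalk.law n (m n))
        (QuenchedWalk.offDiagonal n (m n)) {ω | ω ∉ QuenchedWalk.offDiagonal n (m n) ∧
          (QuenchedWalk.numCycles 1 1 ω : ℝ) ≤ c * √(n : ℝ)}
      rw [pow_zero, mul_one] at h2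
      linarith
    · by_cases h : ω ∈ QuenchedWalk.offDiagonal n (m n)
      · exact Or.inr (Or.inl h)
      · rcases lt_or_ge (c * √(n : ℝ)) (QuenchedWalk.numCycles 1 1 ω : ℝ) with h' | h'
        · exact Or.inl h'
        · exact Or.inr (Or.inr ⟨h, h'⟩)
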